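/- **Conventions.** Let $p$ be a prime. For finite groups $G,H$, a $(G,H)$-biset is a set with a right $G$-action and a commuting left $H$-action; $A(G,H)$ is the Grothendieck group of isomorphism classes of finite $(G,H)$-bisets with free left $H$-action (addition is disjoint union), and $A(G,H)_{(p)}=\mathbb Z_{(p)}\otimes A(G,H)$. Composition $A(H,K)\times A(G,H)\to A(G,K)$ is the bilinear extension of $[X]\circ[Y]=[X\times_H Y]$. For $L\le G$ and a homomorphism $\varphi\colon L\to H$, $[L,\varphi]_G^H\in A(G,H)$ is the class of $(H\times G)/{\sim}$, where $(x\varphi(k),y)\sim(x,ky)$ for $k\in L$. For an injective homomorphism $\varphi\colon P\to H$, $\varphi^{-1}\colon\varphi(P)\to P$ denotes the inverse of $P\cong\varphi(P)$. A fusion system $\mathcal F$ on a finite $p$-group $S$ is *saturated* if it satisfies the Broto--Levi--Oliver axioms: (I) every fully $\mathcal F$-normalized $P\le S$ is fully $\mathcal F$-centralized and $\mathrm{Aut}_S(P)$ is a Sylow $p$-subgroup of $\mathrm{Aut}_{\mathcal F}(P)$; (II) every $\varphi\in\mathrm{Hom}_{\mathcal F}(P,S)$ with $\varphi(P)$ fully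 $\mathcal F$-centralized extends to a morphism $N_\varphi\to S$ in $\mathcal F$. A subgroup $T\le S$ is *strongly $\mathcal F$-closed* if $\varphi(Q)\le T$ for all $Q\le T$ and $\varphi\in\mathrm{Hom}_{\mathcal F}(Q,S)$. A fusion subsystem $\mathcal E$ of $\mathcal F$ on $T\le S$ is *normal* in $\mathcal F$ if $T$ is strongly $\mathcal F$-closed and, for every $\mathcal F$-isomorphism $\varphi\colon Q\to R$ and all $A,B\le Q\cap T$, $$\varphi\circ\mathrm{Hom}_{\mathcal E}(A,B)\circ\varphi^{-1}\subseteq\mathrm{Hom}_{\mathcal E}(\varphi(A),\varphi(B)).$$ A *characteristic idempotent* of a fusion system $\mathcal E$ on $T$ is an element $\omega\in A(T,T)_{(p)}$ with $\omega\circ\omega=\omega$ such that: $\omega$ lies in the $\mathbb Z_{(p)}$-span of the $[P,\varphi]_T^T$ with $P\le T$, $\varphi\in\mathrm{Hom}_{\mathcal E}(P,T)$; for all such $P,\varphi$ one has $\omega\circ[P,\varphi]_P^T=\omega\circ[P,\mathrm{incl}]_P^T$ and $[\varphi(P),\varphi^{-1}]_T^P\circ\omega=[P,1]_T^P\circ\omega$;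 and the augmentation of $\omega$ (the $\mathbb Z_{(p)}$-linear map with $[X]\mapsto|X|/|T|$) is prime to $p$. (A saturated fusion system has exactly one characteristic idempotent.) **Theorem.** Let $\mathcal F$ be a saturated fusion system on a finite $p$-group $S$, let $\mathcal E$ be a saturated fusion subsystem of $\mathcal F$ on a strongly $\mathcal F$-closed subgroup $T\le S$, and let $\omega_{\mathcal E}\in A(T,T)_{(p)}$ be the characteristic idempotent of $\mathcal E$. The following are equivalent: 1. $\mathcal E$ is a normal fusion subsystem of $\mathcal F$. 2. For every subgroup $Q\le T$ and every $\psi\in\mathrm{Hom}_{\mathcal F}(Q,S)$ (so that $\psi(Q)\le T$), the following identity holds in $A(Q,Q)_{(p)}$: $$[\psi(Q),\psi^{-1}]_T^Q\circ\omega_{\mathcal E}\circ[Q,\psi]_Q^T=[Q,1]_T^Q\circ\omega_{\mathcal E}\circ[Q,\mathrm{incl}]_Q^T .$$ -/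

import Mathlib

open scoped TensorProduct

universe u

noncomputable section

/-! ## Bisets -/

/-- A finite left-free `(G, H)`-biset: a finite set with a right `G`-action (an action of `Gᵐᵒᵖ`)
and a commuting left `H`-action, the left action being free. -/
structure LFBiset (G H : Type u) [Group G] [Group H] where
  carrier : Type u
  [finite : Finite carrier]
  [left : MulAction H carrier]
  [right : MulAction Gᵐᵒᵖ carrier]
  [comm : SMulCommClass H Gᵐᵒᵖ carrier]
  left_free : ∀ (h : H) (x : carrier), h • x = x → h = 1

namespace LFBiset

attribute [instance] LFBiset.finite LFBiset.left LFBiset.right LFBiset.comm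

variable {G H K : Type u} [Group G] [Group H] [Group K]

/-- An isomorphism of `(G, H)`-bisets. -/
structure Iso (X Y : LFBiset G H) where
  equiv : X.carrier ≃ Y.carrier
  map_left : ∀ (h : H) (x : X.carrier), equiv (h • x) = h • equiv x
  map_right : ∀ (g : Gᵐᵒᵖ) (x : X.carrier), equiv (g • x) = g • equiv x

/-- `X` and `Y` are isomorphic. -/
instance isoSetoid (G H : Type u) [Group G] [Group H] : Setoid (LFBiset G H) where
  r X Y := Nonempty (Iso X Y)
  iseqv :=
    { refl := fun _ => ⟨⟨Equiv.refl _, fun _ _ => rfl, fun _ _ => rfl⟩⟩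
      symm := by
        rintro X Y ⟨e⟩
        refine ⟨⟨e.equiv.symm, fun h y => ?_, fun g y => ?_⟩⟩
        · rw [Equiv.symm_apply_eq, e.map_left, Equiv.apply_symm_apply]
        · rw [Equiv.symm_apply_eq, e.map_right, Equiv.apply_symm_apply]
      trans := by
        rintro X Y Z ⟨e⟩ ⟨f⟩
        refine ⟨⟨e.equiv.trans f.equiv, fun h x => ?_, fun g x => ?_⟩⟩
        · simp [e.map_left, f.map_left]
        · simp [e.map_right, f.map_right] }

/-- The unique action on the empty set. -/
instance emptyAction (M : Type u) [Monoid M] : MulAction M PEmpty.{u + 1} where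
  smul _ x := x
  one_smul _ := rfl
  mul_smul _ _ _ := rfl

/-- The empty biset. -/
def empty (G H : Type u) [Group G] [Group H] : LFBiset G H where
  carrier := PEmpty.{u + 1}
  comm := ⟨fun _ _ _ => rfl⟩
  left_free := fun _ x => x.elim

/-- Disjoint union of bisets. -/
def sum (X Y : LFBiset G H) : LFBiset G H where
  carrier := X.carrier ⊕ Y.carrier
  left_free := by
    rintro h (x | y) hx
    · exact X.left_free h x (Sum.inl_injective hx)
    · exact Y.left_free h y (Sum.inr_injective hx)

/-- The relation `(x h, y) ∼ (x, h y)` on `X × Y`, for an `(H, K)`-biset `X` and a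
`(G, H)`-biset `Y`. -/
def prodSetoid (X : LFBiset H K) (Y : LFBiset G H) : Setoid (X.carrier × Y.carrier) where
  r a b := ∃ h : H, a.1 = MulOpposite.op h • b.1 ∧ b.2 = h • a.2
  iseqv :=
    { refl := fun a => ⟨1, by simp, by simp⟩
      symm := by
        rintro ⟨x, y⟩ ⟨x', y'⟩ ⟨h, h1, h2⟩
        refine ⟨h⁻¹, ?_, ?_⟩
        · simp only at h1 ⊢
          rw [h1, smul_smul, ← MulOpposite.op_mul, mul_inv_cancel, MulOpposite.op_one, one_smul]
        · simp only at h2 ⊢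
          rw [h2, smul_smul, inv_mul_cancel, one_smul]
      trans := by
        rintro ⟨x, y⟩ ⟨x', y'⟩ ⟨x'', y''⟩ ⟨h, h1, h2⟩ ⟨k, k1, k2⟩
        refine ⟨k * h, ?_, ?_⟩
        · simp only at h1 k1 ⊢
          rw [h1, k1, smul_smul, MulOpposite.op_mul]
        · simp only at h2 k2 ⊢
          rw [k2, h2, smul_smul] }

instance compLeft (X : LFBiset H K) (Y : LFBiset G H) :
    MulAction K (Quotient (prodSetoid X Y)) where
  smul k := Quotient.map (fun a => (k • a.1, a.2)) (by
    rintro ⟨x, y⟩ ⟨x', y'⟩ ⟨h, h1, h2⟩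
    refine ⟨h, ?_, h2⟩
    simp only at h1 ⊢
    rw [h1, smul_comm])
  one_smul := by
    rintro ⟨x, y⟩
    exact congrArg (Quotient.mk (prodSetoid X Y)) (Prod.ext (one_smul K x) rfl)
  mul_smul := by
    rintro k l ⟨x, y⟩
    exact congrArg (Quotient.mk (prodSetoid X Y)) (Prod.ext (mul_smul k l x) rfl)

instance compRight (X : LFBiset H K) (Y : LFBiset G H) :
    MulAction Gᵐᵒᵖ (Quotient (prodSetoid X Y)) where
  smul g := Quotient.map (fun a => (a.1, g • a.2)) (by
    rintro ⟨x, y⟩ ⟨x', y'⟩ ⟨h, h1, h2⟩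
    refine ⟨h, h1, ?_⟩
    simp only at h2 ⊢
    exact h2 ▸ (smul_comm h g y).symm)
  one_smul := by
    rintro ⟨x, y⟩
    exact congrArg (Quotient.mk (prodSetoid X Y)) (Prod.ext rfl (one_smul _ y))
  mul_smul := by
    rintro k l ⟨x, y⟩
    exact congrArg (Quotient.mk (prodSetoid X Y)) (Prod.ext rfl (mul_smul k l y))

/-- The composite `X ∘ Y = X ×_H Y`, a `(G, K)`-biset, with actions `k [x, y] = [k x, y]` and
`[x, y] g = [x, y g]`. -/
def comp (X : LFBiset H K) (Y : LFBiset G H) : LFBiset G K where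
  carrier := Quotient (prodSetoid X Y)
  comm := ⟨by rintro k g ⟨x, y⟩; rfl⟩
  left_free := by
    rintro k ⟨x, y⟩ hk
    obtain ⟨h, h1, h2⟩ : (prodSetoid X Y).r (k • x, y) (x, y) := Quotient.exact hk
    have h3 : h = 1 := Y.left_free h y h2.symm
    subst h3
    refine X.left_free k x ?_
    simpa using h1

theorem sum_congr {X X' Y Y' : LFBiset G H} (hX : X ≈ X') (hY : Y ≈ Y') :
    sum X Y ≈ sum X' Y' := by
  obtain ⟨e⟩ := hX
  obtain ⟨f⟩ := hY
  refine ⟨⟨Equiv.sumCongr e.equiv f.equiv, ?_, ?_⟩⟩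
  · rintro h (x | y)
    · exact congrArg Sum.inl (e.map_left h x)
    · exact congrArg Sum.inr (f.map_left h y)
  · rintro h (x | y)
    · exact congrArg Sum.inl (e.map_right h x)
    · exact congrArg Sum.inr (f.map_right h y)

theorem comp_congr {X X' : LFBiset H K} {Y Y' : LFBiset G H} (hX : X ≈ X') (hY : Y ≈ Y') :
    comp X Y ≈ comp X' Y' := by
  obtain ⟨e⟩ := hX
  obtain ⟨f⟩ := hY
  refine ⟨⟨Quotient.congr (Equiv.prodCongr e.equiv f.equiv) ?_, ?_, ?_⟩⟩
  · rintro ⟨x, y⟩ ⟨x', y'⟩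
    refine exists_congr fun h => ?_
    simp only [Equiv.prodCongr_apply, Prod.map]
    rw [← e.map_right, ← f.map_left, e.equiv.apply_eq_iff_eq, f.equiv.apply_eq_iff_eq]
  · rintro k ⟨x, y⟩
    exact congrArg (Quotient.mk (prodSetoid X' Y')) (Prod.ext (e.map_left k x) rfl)
  · rintro g ⟨x, y⟩
    exact congrArg (Quotient.mk (prodSetoid X' Y')) (Prod.ext rfl (f.map_right g y))

theorem comp_sum_left (X X' : LFBiset H K) (Y : LFBiset G H) :
    comp (sum X X') Y ≈ sum (comp X Y) (comp X' Y) := by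
  let F : (comp (sum X X') Y).carrier → (sum (comp X Y) (comp X' Y)).carrier :=
    Quotient.lift (fun a => match a with
      | (Sum.inl x, y) => Sum.inl (Quotient.mk (prodSetoid X Y) (x, y))
      | (Sum.inr x, y) => Sum.inr (Quotient.mk (prodSetoid X' Y) (x, y))) (by
        rintro ⟨x | x, y⟩ ⟨x' | x', y'⟩ ⟨h, h1, h2⟩
        · exact congrArg Sum.inl (Quotient.sound ⟨h, Sum.inl_injective h1, h2⟩)
        · exact absurd h1 Sum.inl_ne_inr
        · exact absurd h1 Sum.inr_ne_inl
        · exact congrArg Sum.inr (Quotient.sound ⟨h, Sum.inr_injective h1, h2⟩))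
  let B : (sum (comp X Y) (comp X' Y)).carrier → (comp (sum X X') Y).carrier :=
    Sum.elim
      (Quotient.lift (fun a => Quotient.mk (prodSetoid (sum X X') Y) (Sum.inl a.1, a.2)) (by
        rintro ⟨x, y⟩ ⟨x', y'⟩ ⟨h, h1, h2⟩
        exact Quotient.sound ⟨h, congrArg Sum.inl h1, h2⟩))
      (Quotient.lift (fun a => Quotient.mk (prodSetoid (sum X X') Y) (Sum.inr a.1, a.2)) (by
        rintro ⟨x, y⟩ ⟨x', y'⟩ ⟨h, h1, h2⟩
        exact Quotient.sound ⟨h, congrArg Sum.inr h1, h2⟩))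
  refine ⟨⟨⟨F, B, ?_, ?_⟩, ?_, ?_⟩⟩
  · rintro ⟨x | x, y⟩ <;> rfl
  · rintro (⟨x, y⟩ | ⟨x, y⟩) <;> rfl
  · rintro k ⟨x | x, y⟩ <;> rfl
  · rintro k ⟨x | x, y⟩ <;> rfl

theorem comp_sum_right (X : LFBiset H K) (Y Y' : LFBiset G H) :
    comp X (sum Y Y') ≈ sum (comp X Y) (comp X Y') := by
  let F : (comp X (sum Y Y')).carrier → (sum (comp X Y) (comp X Y')).carrier :=
    Quotient.lift (fun a => match a with
      | (x, Sum.inl y) => Sum.inl (Quotient.mk (prodSetoid X Y) (x, y))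
      | (x, Sum.inr y) => Sum.inr (Quotient.mk (prodSetoid X Y') (x, y))) (by
        rintro ⟨x, y | y⟩ ⟨x', y' | y'⟩ ⟨h, h1, h2⟩
        · exact congrArg Sum.inl (Quotient.sound ⟨h, h1, Sum.inl_injective h2⟩)
        · exact absurd h2 Sum.inr_ne_inl
        · exact absurd h2 Sum.inl_ne_inr
        · exact congrArg Sum.inr (Quotient.sound ⟨h, h1, Sum.inr_injective h2⟩))
  let B : (sum (comp X Y) (comp X Y')).carrier → (comp X (sum Y Y')).carrier :=
    Sum.elim
      (Quotient.lift (fun a => Quotient.mk (prodSetoid X (sum Y Y')) (a.1, Sum.inl a.2)) (by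
        rintro ⟨x, y⟩ ⟨x', y'⟩ ⟨h, h1, h2⟩
        exact Quotient.sound ⟨h, h1, congrArg Sum.inl h2⟩))
      (Quotient.lift (fun a => Quotient.mk (prodSetoid X (sum Y Y')) (a.1, Sum.inr a.2)) (by
        rintro ⟨x, y⟩ ⟨x', y'⟩ ⟨h, h1, h2⟩
        exact Quotient.sound ⟨h, h1, congrArg Sum.inr h2⟩))
  refine ⟨⟨⟨F, B, ?_, ?_⟩, ?_, ?_⟩⟩
  · rintro ⟨x, y | y⟩ <;> rfl
  · rintro (⟨x, y⟩ | ⟨x, y⟩) <;> rfl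
  · rintro k ⟨x, y | y⟩ <;> rfl
  · rintro k ⟨x, y | y⟩ <;> rfl

theorem comp_empty_left (Y : LFBiset G H) : comp (empty H K) Y ≈ empty G K := by
  have : IsEmpty (comp (empty H K) Y).carrier := ⟨by rintro ⟨x, y⟩; exact PEmpty.elim x⟩
  exact ⟨⟨⟨fun x => isEmptyElim x, fun x => PEmpty.elim x, fun x => isEmptyElim x,
    fun x => PEmpty.elim x⟩, fun _ x => isEmptyElim x, fun _ x => isEmptyElim x⟩⟩

theorem comp_empty_right (X : LFBiset H K) : comp X (empty G H) ≈ empty G K := by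
  have : IsEmpty (comp X (empty G H)).carrier := ⟨by rintro ⟨x, y⟩; exact PEmpty.elim y⟩
  exact ⟨⟨⟨fun x => isEmptyElim x, fun x => PEmpty.elim x, fun x => isEmptyElim x,
    fun x => PEmpty.elim x⟩, fun _ x => isEmptyElim x, fun _ x => isEmptyElim x⟩⟩

/-- The number of left orbits of a biset, that is `|X| / |H|`. -/
def orbitCount (X : LFBiset G H) : ℕ := Nat.card (MulAction.orbitRel.Quotient H X.carrier)

theorem orbitCount_congr {X Y : LFBiset G H} (h : X ≈ Y) : orbitCount X = orbitCount Y := by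
  obtain ⟨e⟩ := h
  refine Nat.card_congr (Quotient.congr e.equiv fun x y => ?_)
  change (∃ h : H, h • y = x) ↔ (∃ h : H, h • e.equiv y = e.equiv x)
  refine exists_congr fun h => ?_
  rw [← e.map_left, e.equiv.apply_eq_iff_eq]

theorem orbitCount_empty : orbitCount (empty G H) = 0 := by
  have : IsEmpty (MulAction.orbitRel.Quotient H (empty G H).carrier) :=
    ⟨by rintro ⟨x⟩; exact PEmpty.elim x⟩
  exact Nat.card_of_isEmpty

theorem orbitCount_sum (X Y : LFBiset G H) :
    orbitCount (sum X Y) = orbitCount X + orbitCount Y := by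
  rw [orbitCount, orbitCount, orbitCount, ← Nat.card_sum]
  let F : MulAction.orbitRel.Quotient H (sum X Y).carrier →
      MulAction.orbitRel.Quotient H X.carrier ⊕ MulAction.orbitRel.Quotient H Y.carrier :=
    Quotient.lift (fun a => Sum.map (Quotient.mk (MulAction.orbitRel H X.carrier))
      (Quotient.mk (MulAction.orbitRel H Y.carrier)) a) (by
        rintro (x | x) (y | y) ⟨h, hh⟩
        · exact congrArg Sum.inl (Quotient.sound ⟨h, Sum.inl_injective hh⟩)
        · exact absurd hh Sum.inr_ne_inl
        · exact absurd hh Sum.inl_ne_inr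
        · exact congrArg Sum.inr (Quotient.sound ⟨h, Sum.inr_injective hh⟩))
  let B : MulAction.orbitRel.Quotient H X.carrier ⊕ MulAction.orbitRel.Quotient H Y.carrier →
      MulAction.orbitRel.Quotient H (sum X Y).carrier :=
    Sum.elim
      (Quotient.lift (fun a => Quotient.mk (MulAction.orbitRel H (sum X Y).carrier) (Sum.inl a)) (by
        rintro x y ⟨h, hh⟩
        exact Quotient.sound ⟨h, congrArg Sum.inl hh⟩))
      (Quotient.lift (fun a => Quotient.mk (MulAction.orbitRel H (sum X Y).carrier) (Sum.inr a)) (by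
        rintro x y ⟨h, hh⟩
        exact Quotient.sound ⟨h, congrArg Sum.inr hh⟩))
  refine Nat.card_congr ⟨F, B, ?_, ?_⟩
  · rintro ⟨x | x⟩ <;> rfl
  · rintro (x | x) <;> induction x using Quotient.inductionOn <;> rfl

/-- The relation `(x φ(k), y) ∼ (x, k y)` on `H × G`. -/
def transSetoid (L : Subgroup G) (φ : L →* H) : Setoid (H × G) where
  r a b := ∃ k : L, a.1 = b.1 * φ k ∧ b.2 = k * a.2
  iseqv :=
    { refl := fun a => ⟨1, by simp, by simp⟩
      symm := by
        rintro ⟨x, y⟩ ⟨x', y'⟩ ⟨k, h1, h2⟩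
        exact ⟨k⁻¹, by simp_all, by simp_all⟩
      trans := by
        rintro ⟨x, y⟩ ⟨x', y'⟩ ⟨x'', y''⟩ ⟨k, h1, h2⟩ ⟨l, k1, k2⟩
        exact ⟨l * k, by simp_all [mul_assoc], by simp_all [mul_assoc]⟩ }

instance transLeft (L : Subgroup G) (φ : L →* H) : MulAction H (Quotient (transSetoid L φ)) where
  smul h := Quotient.map (fun a => (h * a.1, a.2)) (by
    rintro ⟨x, y⟩ ⟨x', y'⟩ ⟨k, h1, h2⟩
    exact ⟨k, by simp_all [mul_assoc], h2⟩)
  one_smul := by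
    rintro ⟨x, y⟩
    exact congrArg (Quotient.mk (transSetoid L φ)) (Prod.ext (one_mul x) rfl)
  mul_smul := by
    rintro k l ⟨x, y⟩
    exact congrArg (Quotient.mk (transSetoid L φ)) (Prod.ext (mul_assoc k l x) rfl)

instance transRight (L : Subgroup G) (φ : L →* H) :
    MulAction Gᵐᵒᵖ (Quotient (transSetoid L φ)) where
  smul g := Quotient.map (fun a => (a.1, a.2 * g.unop)) (by
    rintro ⟨x, y⟩ ⟨x', y'⟩ ⟨k, h1, h2⟩
    exact ⟨k, h1, by simp_all [mul_assoc]⟩)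
  one_smul := by
    rintro ⟨x, y⟩
    exact congrArg (Quotient.mk (transSetoid L φ)) (Prod.ext rfl (mul_one y))
  mul_smul := by
    rintro k l ⟨x, y⟩
    exact congrArg (Quotient.mk (transSetoid L φ))
      (Prod.ext rfl (mul_assoc y l.unop k.unop).symm)

/-- The transitive biset `H ×_(L, φ) G` of a `(G, H)`-pair `(L, φ)`: here `L ≤ G` and
`φ : L → H`, and the actions are `h [x, y] = [h x, y]` and `[x, y] g = [x, y g]`. -/
def trans [Finite G] [Finite H] (L : Subgroup G) (φ : L →* H) : LFBiset G H where
  carrier := Quotient (transSetoid L φ)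
  comm := ⟨by rintro k g ⟨x, y⟩; rfl⟩
  left_free := by
    rintro h ⟨x, y⟩ hh
    obtain ⟨k, h1, h2⟩ : (transSetoid L φ).r (h * x, y) (x, y) := Quotient.exact hh
    have hk : k = 1 := by
      apply Subtype.ext
      simpa using h2
    subst hk
    simpa using h1

end LFBiset

/-! ## Burnside modules -/

/-- Isomorphism classes of finite left-free `(G, H)`-bisets. -/
def BisetClass (G H : Type u) [Group G] [Group H] : Type (u + 1) :=
  Quotient (LFBiset.isoSetoid G H)

namespace BisetClass

variable {G H K : Type u} [Group G] [Group H] [Group K]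

/-- The class of a biset. -/
def mk (X : LFBiset G H) : BisetClass G H := Quotient.mk (LFBiset.isoSetoid G H) X

/-- Isomorphism classes are added by disjoint union; zero is the class of the empty biset. -/
instance : Add (BisetClass G H) where
  add := Quotient.map₂ LFBiset.sum fun _ _ hX _ _ hY => LFBiset.sum_congr hX hY

instance : Zero (BisetClass G H) where
  zero := mk (LFBiset.empty G H)

/-- Isomorphism classes form a commutative monoid under disjoint union. -/
instance : AddCommMonoid (BisetClass G H) where
  nsmul := nsmulRec
  add_assoc := by
    rintro ⟨X⟩ ⟨Y⟩ ⟨Z⟩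
    refine Quotient.sound ⟨⟨Equiv.sumAssoc _ _ _, ?_, ?_⟩⟩
    · rintro h ((x | x) | x) <;> rfl
    · rintro h ((x | x) | x) <;> rfl
  zero_add := by
    rintro ⟨X⟩
    refine Quotient.sound ⟨⟨Equiv.emptySum PEmpty _, ?_, ?_⟩⟩
    · rintro h (x | x)
      · exact PEmpty.elim x
      · rfl
    · rintro h (x | x)
      · exact PEmpty.elim x
      · rfl
  add_zero := by
    rintro ⟨X⟩
    refine Quotient.sound ⟨⟨Equiv.sumEmpty _ PEmpty, ?_, ?_⟩⟩
    · rintro h (x | x)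
      · rfl
      · exact PEmpty.elim x
    · rintro h (x | x)
      · rfl
      · exact PEmpty.elim x
  add_comm := by
    rintro ⟨X⟩ ⟨Y⟩
    refine Quotient.sound ⟨⟨Equiv.sumComm _ _, ?_, ?_⟩⟩
    · rintro h (x | x) <;> rfl
    · rintro h (x | x) <;> rfl

/-- Composition of isomorphism classes, `[X] ∘ [Y] = [X ×_H Y]`, as a biadditive map. -/
def comp : BisetClass H K →+ BisetClass G H →+ BisetClass G K where
  toFun a :=
    { toFun := fun b => Quotient.map₂ LFBiset.comp
        (fun _ _ hX _ _ hY => LFBiset.comp_congr hX hY) a b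
      map_zero' := by
        obtain ⟨X⟩ := a
        exact Quotient.sound (LFBiset.comp_empty_right X)
      map_add' := by
        obtain ⟨X⟩ := a
        rintro ⟨Y⟩ ⟨Y'⟩
        exact Quotient.sound (LFBiset.comp_sum_right X Y Y') }
  map_zero' := by
    ext ⟨Y⟩
    exact Quotient.sound (LFBiset.comp_empty_left Y)
  map_add' := by
    rintro ⟨X⟩ ⟨X'⟩
    ext ⟨Y⟩
    exact Quotient.sound (LFBiset.comp_sum_left X X' Y)

/-- The number of left orbits, on isomorphism classes. -/
def orbitCount : BisetClass G H →+ ℤ where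
  toFun := Quotient.lift (fun X => (LFBiset.orbitCount X : ℤ))
    fun _ _ h => congrArg Nat.cast (LFBiset.orbitCount_congr h)
  map_zero' := congrArg Nat.cast LFBiset.orbitCount_empty
  map_add' := by
    rintro ⟨X⟩ ⟨Y⟩
    exact (congrArg Nat.cast (LFBiset.orbitCount_sum X Y)).trans (Nat.cast_add _ _)

end BisetClass

/-- The Burnside module `A(G, H)`: the Grothendieck group of the monoid of isomorphism classes of
finite left-free `(G, H)`-bisets. -/
def Burnside (G H : Type u) [Group G] [Group H] : Type (u + 1) :=
  Algebra.GrothendieckAddGroup (BisetClass G H)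

instance (G H : Type u) [Group G] [Group H] : AddCommGroup (Burnside G H) :=
  inferInstanceAs (AddCommGroup (Algebra.GrothendieckAddGroup (BisetClass G H)))

namespace Burnside

variable {G H K : Type u} [Group G] [Group H] [Group K]

/-- The canonical map from the monoid of isomorphism classes to `A(G, H)`. -/
def of : BisetClass G H →+ Burnside G H := Algebra.GrothendieckAddGroup.of

/-- The extension of an additive map to `A(G, H)`. -/
def lift {M : Type*} [AddCommGroup M] : (BisetClass G H →+ M) ≃ (Burnside G H →+ M) :=
  Algebra.GrothendieckAddGroup.lift

theorem lift_of {M : Type*} [AddCommGroup M] (f : BisetClass G H →+ M) (x : BisetClass G H) :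
    lift f (of x) = f x :=
  DFunLike.congr_fun (lift.symm_apply_apply f) x

/-- The element of `A(G, H)` given by a biset. -/
def ofBiset (X : LFBiset G H) : Burnside G H := of (BisetClass.mk X)

/-- The composition pairing `A(H, K) × A(G, H) → A(G, K)`, the biadditive extension of
`[X] ∘ [Y] = [X ×_H Y]`. -/
def comp : Burnside H K →+ Burnside G H →+ Burnside G K :=
  lift
    { toFun := fun a => lift (of.comp (BisetClass.comp a))
      map_zero' := by
        rw [← Equiv.eq_symm_apply]
        refine AddMonoidHom.ext fun b => ?_
        change of (BisetClass.comp 0 b) = 0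
        simp
      map_add' := fun a a' => by
        rw [← Equiv.eq_symm_apply]
        refine AddMonoidHom.ext fun b => ?_
        refine Eq.trans ?_ (congrArg₂ (· + ·) (lift_of (of.comp (BisetClass.comp a)) b)
          (lift_of (of.comp (BisetClass.comp a')) b)).symm
        simp }

theorem comp_ofBiset (X : LFBiset H K) (Y : LFBiset G H) :
    comp (ofBiset X) (ofBiset Y) = ofBiset (X.comp Y) :=
  (DFunLike.congr_fun (lift_of _ _) _).trans (lift_of _ _)

/-- The augmentation `A(G, H) → ℤ`, `[X] ↦ |X| / |H|`. -/
def aug : Burnside G H →+ ℤ := lift BisetClass.orbitCount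

end Burnside

/-! ## `p`-localization -/

instance spanPrime_isPrime (p : ℕ) [hp : Fact p.Prime] : (Ideal.span {(p : ℤ)}).IsPrime :=
  (Ideal.span_singleton_prime (Int.natCast_ne_zero.mpr hp.out.ne_zero)).mpr
    (Nat.prime_iff_prime_int.mp hp.out)

/-- The ring `ℤ_(p)`: the localization of `ℤ` at the prime ideal `(p)`. -/
def ZLoc (p : ℕ) [Fact p.Prime] : Type := Localization.AtPrime (Ideal.span {(p : ℤ)})

instance (p : ℕ) [Fact p.Prime] : CommRing (ZLoc p) :=
  inferInstanceAs (CommRing (Localization.AtPrime (Ideal.span {(p : ℤ)})))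

instance (p : ℕ) [Fact p.Prime] : IsLocalization.AtPrime (ZLoc p) (Ideal.span {(p : ℤ)}) := by
  have h : IsLocalization.AtPrime (Localization.AtPrime (Ideal.span {(p : ℤ)}))
    (Ideal.span {(p : ℤ)}) := inferInstance
  convert! h
  exact Subsingleton.elim (α := Algebra ℤ (ZLoc p)) _ _

/-- The `p`-localization `A(G, H)_(p) = ℤ_(p) ⊗ A(G, H)`. -/
abbrev BurnsideLoc (p : ℕ) [Fact p.Prime] (G H : Type u) [Group G] [Group H] : Type (u + 1) :=
  ZLoc p ⊗[ℤ] Burnside G H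

namespace BurnsideLoc

variable {p : ℕ} [Fact p.Prime] {G H K : Type u} [Group G] [Group H] [Group K]

/-- The composition pairing on `p`-localizations:
`(r ⊗ X) ∘ (s ⊗ Y) = (r s) ⊗ (X ∘ Y)`. -/
def comp (X : BurnsideLoc p H K) (Y : BurnsideLoc p G H) : BurnsideLoc p G K :=
  TensorProduct.map
    (TensorProduct.liftAddHom (AddMonoidHom.mul (R := ZLoc p))
      (fun n x y => by simp [mul_left_comm, mul_assoc])).toIntLinearMap
    (TensorProduct.liftAddHom Burnside.comp (fun n x y => by simp)).toIntLinearMap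
    (TensorProduct.tensorTensorTensorComm ℤ (ZLoc p) (Burnside H K) (ZLoc p) (Burnside G H)
      (X ⊗ₜ[ℤ] Y))

theorem comp_tmul (r s : ZLoc p) (X : Burnside H K) (Y : Burnside G H) :
    comp (r ⊗ₜ[ℤ] X) (s ⊗ₜ[ℤ] Y) = (r * s) ⊗ₜ[ℤ] Burnside.comp X Y := by
  rfl

/-- The augmentation `A(G, H)_(p) → ℤ_(p)`, `r ⊗ X ↦ r ε(X)`. -/
def aug : BurnsideLoc p G H →+ ZLoc p :=
  TensorProduct.liftAddHom
    ((AddMonoidHom.mul (R := ZLoc p)).compl₂ ((Int.castAddHom (ZLoc p)).comp Burnside.aug))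
    (fun n x y => by simp [mul_left_comm, mul_assoc])

theorem aug_tmul (r : ZLoc p) (X : Burnside G H) :
    aug (r ⊗ₜ[ℤ] X) = r * (Burnside.aug X : ZLoc p) := rfl

/-- The standard basis element `[L, φ]` of `A(G, H)_(p)`, for `L ≤ G` and `φ : L → H`. -/
def basis (p : ℕ) [Fact p.Prime] [Finite G] [Finite H] (L : Subgroup G) (φ : L →* H) :
    BurnsideLoc p G H :=
  (1 : ZLoc p) ⊗ₜ[ℤ] Burnside.ofBiset (LFBiset.trans L φ)

/-- The element `[G, f]` of `A(G, H)_(p)`, for a homomorphism `f : G → H`. -/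
def res (p : ℕ) [Fact p.Prime] [Finite G] [Finite H] (f : G →* H) : BurnsideLoc p G H :=
  basis p (⊤ : Subgroup G) (f.comp (⊤ : Subgroup G).subtype)

/-- The element `[f(G), f⁻¹]` of `A(H, G)_(p)`, for an injective homomorphism `f : G → H`. -/
def tr (p : ℕ) [Fact p.Prime] [Finite G] [Finite H] (f : G →* H) (hf : Function.Injective f) :
    BurnsideLoc p H G :=
  basis p f.range (MonoidHom.ofInjective hf).symm.toMonoidHom

end BurnsideLoc

/-! ## Fusion systems -/

/-- A fusion system on a group `S` (applied to finite `p`-groups): a category whose objects are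
the subgroups of `S`, whose morphisms are injective group homomorphisms, composed as such. -/
structure FusionSystem (S : Type u) [Group S] where
  /-- The morphisms from `P` to `Q`. -/
  Hom : (P Q : Subgroup S) → Set (P →* Q)
  injective : ∀ {P Q : Subgroup S} {φ : P →* Q}, φ ∈ Hom P Q → Function.Injective φ
  /-- Conjugation by an element of `S` that takes `P` into `Q` is a morphism. -/
  conj_mem : ∀ {P Q : Subgroup S} (g : S) (φ : P →* Q),
    (∀ u : P, (φ u : S) = g * u * g⁻¹) → φ ∈ Hom P Q
  /-- The isomorphism `P ≃ φ(P)` induced by a morphism `φ` is a morphism. -/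
  corestrict_mem : ∀ {P Q R : Subgroup S} {φ : P →* Q}, φ ∈ Hom P Q → ∀ e : P ≃* R,
    (∀ u : P, (e u : S) = φ u) → e.toMonoidHom ∈ Hom P R
  /-- The inverse of the isomorphism `P ≃ φ(P)` induced by a morphism `φ` is a morphism. -/
  symm_mem : ∀ {P Q R : Subgroup S} {φ : P →* Q}, φ ∈ Hom P Q → ∀ e : P ≃* R,
    (∀ u : P, (e u : S) = φ u) → e.symm.toMonoidHom ∈ Hom R P
  comp_mem : ∀ {P Q R : Subgroup S} {φ : P →* Q} {χ : Q →* R}, φ ∈ Hom P Q → χ ∈ Hom Q R →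
    χ.comp φ ∈ Hom P R

namespace FusionSystem

variable {S : Type u} [Group S]

/-- A homomorphism `P → Q` seen as a homomorphism `P → S`. -/
def amb {P Q : Subgroup S} (φ : P →* Q) : P →* S := Q.subtype.comp φ

theorem amb_injective (F : FusionSystem S) {P Q : Subgroup S} {φ : P →* Q} (h : φ ∈ F.Hom P Q) :
    Function.Injective (amb φ) :=
  (Subgroup.subtype_injective Q).comp (F.injective h)

/-- `P` and `Q` are `F`-conjugate. -/
def IsConj (F : FusionSystem S) (P Q : Subgroup S) : Prop :=
  ∃ e : P ≃* Q, e.toMonoidHom ∈ F.Hom P Q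

/-- `P` is fully `F`-centralized. -/
def FullyCentralized (F : FusionSystem S) (P : Subgroup S) : Prop :=
  ∀ Q : Subgroup S, F.IsConj P Q →
    Nat.card (Subgroup.centralizer (Q : Set S)) ≤ Nat.card (Subgroup.centralizer (P : Set S))

/-- `P` is fully `F`-normalized. -/
def FullyNormalized (F : FusionSystem S) (P : Subgroup S) : Prop :=
  ∀ Q : Subgroup S, F.IsConj P Q →
    Nat.card (Subgroup.normalizer (Q : Set S)) ≤ Nat.card (Subgroup.normalizer (P : Set S))

/-- The group `Aut_F(P)`. -/
def aut (F : FusionSystem S) (P : Subgroup S) : Subgroup (MulAut P) where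
  carrier := {e | MulEquiv.toMonoidHom e ∈ F.Hom P P}
  one_mem' := F.conj_mem 1 _ fun u => by simp
  mul_mem' := fun {_ _} ha hb => F.comp_mem hb ha
  inv_mem' := fun {e} he => F.symm_mem he e fun _ => rfl

/-- The group `Aut_S(P)` of automorphisms of `P` induced by conjugation in `S`. -/
def autS (P : Subgroup S) : Subgroup (MulAut P) := P.normalizerMonoidHom.range

/-- The subgroup `N_φ` of the normalizer of `P`, for `φ : P → S`. -/
def extNormalizer {P : Subgroup S} (φ : P →* S) : Subgroup S where
  carrier := {x | x ∈ Subgroup.normalizer (P : Set S) ∧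
    ∃ y ∈ Subgroup.normalizer (φ.range : Set S), ∀ u v : P, (v : S) = x * u * x⁻¹ →
      φ v = y * φ u * y⁻¹}
  one_mem' := ⟨one_mem _, 1, one_mem _, fun u v h => by
    have : v = u := Subtype.ext (by simpa using h)
    simp [this]⟩
  mul_mem' := by
    rintro a b ⟨ha, y, hy, h1⟩ ⟨hb, z, hz, h2⟩
    refine ⟨mul_mem ha hb, y * z, mul_mem hy hz, fun u v h => ?_⟩
    have hw : b * u * b⁻¹ ∈ P := (Subgroup.mem_normalizer_iff.mp hb u).mp u.2
    rw [h1 ⟨_, hw⟩ v (by simp [h, mul_assoc]), h2 u ⟨_, hw⟩ rfl]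
    simp [mul_assoc]
  inv_mem' := by
    rintro a ⟨ha, y, hy, h1⟩
    refine ⟨inv_mem ha, y⁻¹, inv_mem hy, fun u v h => ?_⟩
    rw [h1 v u (by simp [h, mul_assoc])]
    simp [mul_assoc]

theorem le_extNormalizer {P : Subgroup S} (φ : P →* S) : P ≤ extNormalizer φ := by
  intro x hx
  refine ⟨Subgroup.le_normalizer hx, φ ⟨x, hx⟩, Subgroup.le_normalizer ⟨_, rfl⟩, fun u v h => ?_⟩
  have : v = ⟨x, hx⟩ * u * ⟨x, hx⟩⁻¹ := Subtype.ext h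
  simp [this]

/-- The saturation axioms for a fusion system on a finite `p`-group. -/
structure Saturated (p : ℕ) (F : FusionSystem S) : Prop where
  /-- If `P` is fully normalized, then it is fully centralized and `Aut_S(P)` is a Sylow
  `p`-subgroup of `Aut_F(P)`. -/
  sylow : ∀ P : Subgroup S, F.FullyNormalized P → F.FullyCentralized P ∧
    ∃ A : Sylow p (F.aut P), (A : Subgroup (F.aut P)) = (autS P).subgroupOf (F.aut P)
  /-- If `φ(P)` is fully centralized, then `φ` extends to `N_φ`. -/
  extend : ∀ (P : Subgroup S) (φ : P →* (⊤ : Subgroup S)), φ ∈ F.Hom P ⊤ →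
    F.FullyCentralized (amb φ).range →
    ∃ χ ∈ F.Hom (extNormalizer (amb φ)) ⊤,
      χ.comp (Subgroup.inclusion (le_extNormalizer (amb φ))) = φ

/-- `T` is strongly `F`-closed. -/
def StronglyClosed (F : FusionSystem S) (T : Subgroup S) : Prop :=
  ∀ Q : Subgroup S, Q ≤ T → ∀ φ ∈ F.Hom Q ⊤, (amb φ).range ≤ T

/-- For `T` strongly closed and `Q ≤ T`, a morphism `ψ ∈ Hom_F(Q, S)` as a map `Q → T`. -/
def StronglyClosed.toMap {F : FusionSystem S} {T : Subgroup S} (hT : F.StronglyClosed T)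
    {Q : Subgroup S} (hQ : Q ≤ T) {ψ : Q →* (⊤ : Subgroup S)} (hψ : ψ ∈ F.Hom Q ⊤) : Q →* T :=
  (amb ψ).codRestrict T fun u => hT Q hQ ψ hψ ⟨u, rfl⟩

theorem StronglyClosed.toMap_injective {F : FusionSystem S} {T : Subgroup S}
    (hT : F.StronglyClosed T) {Q : Subgroup S} (hQ : Q ≤ T) {ψ : Q →* (⊤ : Subgroup S)}
    (hψ : ψ ∈ F.Hom Q ⊤) : Function.Injective (hT.toMap hQ hψ) := fun _ _ h =>
  F.amb_injective hψ (congrArg (fun t : T => (t : S)) h)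

/-- For `A, B ≤ T ≤ S`, a homomorphism `A → B`, where `A` and `B` are seen as subgroups of `S`. -/
def push {T : Subgroup S} {A B : Subgroup T} (φ : A →* B) :
    A.map T.subtype →* B.map T.subtype :=
  (B.equivMapOfInjective T.subtype T.subtype_injective).toMonoidHom.comp
    (φ.comp (A.equivMapOfInjective T.subtype T.subtype_injective).symm.toMonoidHom)

/-- `E`, a fusion system on `T ≤ S`, is a subsystem of `F`: its morphisms are morphisms of `F`. -/
def IsSubsystem (F : FusionSystem S) {T : Subgroup S} (E : FusionSystem T) : Prop :=
  ∀ (A B : Subgroup T), ∀ φ ∈ E.Hom A B, push φ ∈ F.Hom (A.map T.subtype) (B.map T.subtype)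

/-- `E`, a fusion subsystem on `T ≤ S`, is normal in `F`: `T` is strongly closed, and for every
`F`-isomorphism `φ : Q → R` and all `A, B ≤ Q ∩ T` conjugation by `φ` takes `Hom_E(A, B)` into
`Hom_E(φ(A), φ(B))`. Below `A'` is `φ(A)`, `B'` is `φ(B)`, and `eA : A ≃ A'`, `eB : B ≃ B'` are
the restrictions of `φ`. -/
structure IsNormal (F : FusionSystem S) {T : Subgroup S} (E : FusionSystem T) : Prop where
  isSubsystem : F.IsSubsystem E
  stronglyClosed : F.StronglyClosed T
  conj_mem : ∀ (Q R : Subgroup S) (φ : Q ≃* R), φ.toMonoidHom ∈ F.Hom Q R →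
    ∀ (A B A' B' : Subgroup T) (hA : A.map T.subtype ≤ Q) (hB : B.map T.subtype ≤ Q)
      (eA : A ≃* A') (eB : B ≃* B'),
      (∀ a : A, ((eA a : T) : S) = φ ⟨a, hA (Subgroup.mem_map_of_mem T.subtype a.2)⟩) →
      (∀ b : B, ((eB b : T) : S) = φ ⟨b, hB (Subgroup.mem_map_of_mem T.subtype b.2)⟩) →
      ∀ θ ∈ E.Hom A B, (eB.toMonoidHom.comp (θ.comp eA.symm.toMonoidHom)) ∈ E.Hom A' B'

/-! ## Characteristic idempotents -/

variable [Finite S] {p : ℕ} [Fact p.Prime]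

/-- `X` lies in the `ℤ_(p)`-submodule generated by the `[P, φ]` with `φ ∈ Hom_F(P, S)`. -/
def Generated (F : FusionSystem S) (X : BurnsideLoc p S S) : Prop :=
  X ∈ Submodule.span (ZLoc p)
    {Y : BurnsideLoc p S S | ∃ (P : Subgroup S) (φ : P →* (⊤ : Subgroup S)), φ ∈ F.Hom P ⊤ ∧
      Y = BurnsideLoc.basis p P (amb φ)}

/-- `X ∘ [P, φ] = X ∘ [P, incl]` in `A(P, S)_(p)` for all `φ ∈ Hom_F(P, S)`. -/
def RightStable (F : FusionSystem S) (X : BurnsideLoc p S S) : Prop :=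
  ∀ (P : Subgroup S) (φ : P →* (⊤ : Subgroup S)), φ ∈ F.Hom P ⊤ →
    BurnsideLoc.comp X (BurnsideLoc.res p (amb φ)) =
      BurnsideLoc.comp X (BurnsideLoc.res p P.subtype)

/-- `[φ(P), φ⁻¹] ∘ X = [P, 1] ∘ X` in `A(S, P)_(p)` for all `φ ∈ Hom_F(P, S)`. -/
def LeftStable (F : FusionSystem S) (X : BurnsideLoc p S S) : Prop :=
  ∀ (P : Subgroup S) (φ : P →* (⊤ : Subgroup S)) (hφ : φ ∈ F.Hom P ⊤),
    BurnsideLoc.comp (BurnsideLoc.tr p (amb φ) (F.amb_injective hφ)) X =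
      BurnsideLoc.comp (BurnsideLoc.tr p P.subtype P.subtype_injective) X

/-- `ω ∈ A(S, S)_(p)` is a characteristic idempotent of `F`. -/
structure IsCharIdempotent (F : FusionSystem S) (ω : BurnsideLoc p S S) : Prop where
  generated : F.Generated ω
  rightStable : F.RightStable ω
  leftStable : F.LeftStable ω
  /-- The augmentation of `ω` is prime to `p`, that is, not divisible by `p` in `ℤ_(p)`. -/
  aug_prime : ¬ (p : ZLoc p) ∣ BurnsideLoc.aug ω
  idem : BurnsideLoc.comp ω ω = ω

end FusionSystem

end

/-! For homomorphisms `a : L → G` and `b : L → H`, the mark of a `(G, H)`-biset at `(a, b)` is the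
number of points `x` with `x a(l) = b(l) x` for all `l`. Marks extend linearly to `A(G, H)_(p)`, and
by Burnside's theorem on finite sets with an action they determine its elements (`ext_mark`).
Composing with `[Q, ψ]` on the right and `[ψ(Q), ψ⁻¹]` on the left only restricts the two actions,
so condition 2 says that the mark of `ω` at `(ψ ∘ incl, ψ ∘ φ)` equals its mark at `(incl, φ)`, for
all `P ≤ Q` and `φ : P → Q`.

The marks of `ω` at pairs with `a` injective can be computed. Since `ω` is spanned by the `[P, φ]`
with `φ` in `E`, its mark at `(a, b)` vanishes unless `b = θ ∘ a` for a morphism `θ` of `E`. By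
stability the mark is then `m(a)`, the mark at `(a, a)`. Up to the factor `|T|`, marks turn
composition into multiplication of matrices, so `ω ∘ ω = ω` gives `|T| m(a) = n(a) m(a)²`, where
`n(a)` is the number of `E`-conjugates of `a`. The sum of the marks at `(a, ρ)` over all `ρ` is
`|T|` times a number congruent mod `p` to the augmentation. Hence `m(a) ≠ 0` (`mark_self_ne_zero`),
and so `|T| = n(a) m(a)` (`card_eq_mul_mark`). Thus the nonzero marks of `ω` at pairs with `a`
injective are exactly those at pairs related by `E`.

Condition 2 therefore implies normality: a morphism `θ` of `E` gives a nonzero mark, the mark at the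
transported pair is the same, so the transported morphism is in `E`.

Conversely, a morphism `ψ` of `F` has to preserve `n`. It cannot simply be applied to the
`E`-conjugates of `Q`, as they need not lie in its domain. The remedy is a Frattini property
(`IsNormal.factors`): a morphism of `F` between subgroups of `T` is the restriction of some `α ∈
Aut_F(T)` followed by a morphism of `E`. Stability absorbs the latter, and `α` is defined on all of
`T` and permutes the `E`-classes (`mark_aut`). The Frattini property is proved by downward induction
on the order of the domain, through fully normalized subgroups `P` and the Sylow form of the
Frattini argument for `Aut_E(P)`, which is normal in `Aut_F(P)`. -/

/-! ## Fixed points of bisets -/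

namespace LFBiset

variable {G H K L : Type u} [Group G] [Group H] [Group K] [Group L]

/-- The points `x` with `x a(l) = b(l) x` for all `l`. -/
def fixSet (a : L →* G) (b : L →* H) (X : LFBiset G H) : Set X.carrier :=
  {x | ∀ l, MulOpposite.op (a l) • x = b l • x}

/-- The number of points `x` with `x a(l) = b(l) x` for all `l`. -/
noncomputable def fixCard (a : L →* G) (b : L →* H) (X : LFBiset G H) : ℕ :=
  Nat.card (fixSet a b X)

theorem smul_left_cancel_of_free (X : LFBiset G H) {h k : H} {x : X.carrier}
    (e : h • x = k • x) : h = k := by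
  have := X.left_free (k⁻¹ * h) x (by rw [mul_smul, e, inv_smul_smul])
  exact (inv_mul_eq_one.mp this).symm

theorem fixCard_congr (a : L →* G) (b : L →* H) {X Y : LFBiset G H} (h : X ≈ Y) :
    fixCard a b X = fixCard a b Y := by
  obtain ⟨e⟩ := h
  refine Nat.card_congr (e.equiv.subtypeEquiv fun x => ?_)
  refine forall_congr' fun l => ?_
  rw [← e.map_left, ← e.map_right, e.equiv.apply_eq_iff_eq]

theorem fixCard_empty (a : L →* G) (b : L →* H) : fixCard a b (empty G H) = 0 := by
  have : IsEmpty (fixSet a b (empty G H)) := ⟨fun x => PEmpty.elim x.1⟩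
  exact Nat.card_of_isEmpty

theorem fixCard_sum (a : L →* G) (b : L →* H) (X Y : LFBiset G H) :
    fixCard a b (sum X Y) = fixCard a b X + fixCard a b Y := by
  rw [fixCard, fixCard, fixCard, ← Nat.card_sum]
  refine Nat.card_congr (Equiv.trans (Equiv.subtypeSum (p := (· ∈ fixSet a b (sum X Y))))
    (Equiv.sumCongr (Equiv.subtypeEquivRight fun x => ?_) (Equiv.subtypeEquivRight fun y => ?_)))
  · exact forall_congr' fun l => Sum.inl_injective.eq_iff
  · exact forall_congr' fun l => Sum.inr_injective.eq_iff

/-- Only the image of `(a, b)` in `G × H` matters. This allows an arbitrary `a` to be replaced by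
the inclusion of its range. -/
theorem fixCard_comp_surjective {M : Type u} [Group M] (a : L →* G) (b : L →* H) (e : M →* L)
    (he : Function.Surjective e) (X : LFBiset G H) :
    fixCard (a.comp e) (b.comp e) X = fixCard a b X :=
  Nat.card_congr (Equiv.subtypeEquivRight fun x => (he.forall (p := fun l =>
    MulOpposite.op (a l) • x = b l • x)).symm)

/-- Restriction of the right action along `f` does not change the underlying set. -/
theorem fixCard_comp_res {G' : Type u} [Group G'] [Finite G'] [Finite G] (X : LFBiset G H)
    (f : G' →* G) (a : L →* G') (b : L →* H) :
    fixCard a b (X.comp (trans ⊤ (f.comp (⊤ : Subgroup G').subtype))) =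
      fixCard (f.comp a) b X := by
  set Y := trans ⊤ (f.comp (⊤ : Subgroup G').subtype)
  let m (h : G) (g : G') : Y.carrier := Quotient.mk (transSetoid _ _) (h, g)
  have hm (h : G) (g : G') : m h g = m (h * f g) 1 :=
    (Quotient.sound ⟨⟨g, trivial⟩, rfl, by simp⟩ : m (h * f g) 1 = m h g).symm
  -- Every class `[x, [h, g]]` equals `[x · h f(g), [1, 1]]`, so `F` identifies `X` with the
  -- composite; right multiplication by `g` becomes right multiplication by `f(g)`.
  let F (x : X.carrier) : (X.comp Y).carrier := Quotient.mk (prodSetoid X Y) (x, m 1 1)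
  have hF (x : X.carrier) (h : G) :
      Quotient.mk (prodSetoid X Y) (x, m h 1) = F (MulOpposite.op h • x) := by
    refine (Quotient.sound ⟨h, rfl, ?_⟩ : F (MulOpposite.op h • x) = _).symm
    change m h 1 = m (h * 1) 1
    rw [mul_one]
  have hbij : Function.Bijective F := by
    constructor
    · intro x x' e
      obtain ⟨h, h1, h2⟩ := Quotient.exact e
      have : h = 1 := Y.left_free h _ h2.symm
      subst this
      simpa using h1
    · rintro ⟨x, ⟨h, g⟩⟩
      refine ⟨MulOpposite.op (h * f g) • x, ?_⟩
      rw [← hF, ← hm]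
      rfl
  refine (Nat.card_congr ((Equiv.ofBijective F hbij).subtypeEquiv fun x => ?_)).symm
  refine forall_congr' fun l => ?_
  have h1 : MulOpposite.op (a l) • F x = F (MulOpposite.op (f (a l)) • x) := by
    rw [← hF, ← one_mul (f (a l)), ← hm]
    change Quotient.mk (prodSetoid X Y) (x, m 1 (1 * a l)) = _
    rw [one_mul]
  change _ ↔ MulOpposite.op (a l) • F x = F (b l • x)
  rw [h1, hbij.1.eq_iff]
  rfl

/-- Restriction of the left action along `f` does not change the underlying set. -/
theorem fixCard_tr_comp {H' : Type u} [Group H'] [Finite H'] [Finite H] (X : LFBiset G H)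
    (f : H' →* H) (hf : Function.Injective f) (a : L →* G) (b : L →* H') :
    fixCard a b ((trans f.range (MonoidHom.ofInjective hf).symm.toMonoidHom).comp X) =
      fixCard a (f.comp b) X := by
  set Y := trans f.range (MonoidHom.ofInjective hf).symm.toMonoidHom
  let m (h' : H') (h : H) : Y.carrier := Quotient.mk (transSetoid _ _) (h', h)
  have hm (h' : H') (h : H) : m h' h = m 1 (f h' * h) := by
    refine Quotient.sound ⟨MonoidHom.ofInjective hf h', ?_, rfl⟩
    change h' = 1 * (MonoidHom.ofInjective hf).symm (MonoidHom.ofInjective hf h')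
    simp
  let F (x : X.carrier) : (Y.comp X).carrier := Quotient.mk (prodSetoid Y X) (m 1 1, x)
  have hF (x : X.carrier) (h : H) :
      Quotient.mk (prodSetoid Y X) (m 1 h, x) = F (h • x) := by
    refine Quotient.sound ⟨h, ?_, rfl⟩
    change m 1 h = m 1 (1 * h)
    rw [one_mul]
  have hbij : Function.Bijective F := by
    constructor
    · intro x x' e
      obtain ⟨h, h1, h2⟩ := Quotient.exact e
      obtain ⟨k, k1, k2⟩ := Quotient.exact (h1 : m 1 1 = m 1 (1 * h))
      have hk : k = 1 := by simpa using k1.symm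
      subst hk
      have hh : h = 1 := by simpa using k2
      subst hh
      simpa using h2.symm
    · rintro ⟨⟨h', h⟩, x⟩
      refine ⟨(f h' * h) • x, ?_⟩
      rw [← hF, ← hm]
      rfl
  refine (Nat.card_congr ((Equiv.ofBijective F hbij).subtypeEquiv fun x => ?_)).symm
  refine forall_congr' fun l => ?_
  have h1 : b l • F x = F (f (b l) • x) := by
    rw [← hF, ← mul_one (f (b l)), ← hm]
    change Quotient.mk (prodSetoid Y X) (m (b l * 1) 1, x) = _
    rw [mul_one]
  change _ ↔ F (MulOpposite.op (a l) • x) = b l • F x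
  rw [h1, hbij.1.eq_iff]
  rfl

/-- The pairs `(x, y)` with `[x, y]` fixed, counted in two ways. -/
theorem card_mul_fixCard_comp [Finite H] [Fintype (L →* H)] (X : LFBiset H K) (Y : LFBiset G H)
    (a : L →* G) (c : L →* K) :
    Nat.card H * fixCard a c (X.comp Y) = ∑ ρ : L →* H, fixCard ρ c X * fixCard a ρ Y := by
  let q (w : X.carrier × Y.carrier) : (X.comp Y).carrier := Quotient.mk (prodSetoid X Y) w
  have key (x : X.carrier) (y : Y.carrier) (l : L) :
      MulOpposite.op (a l) • q (x, y) = c l • q (x, y) ↔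
        ∃ h : H, c l • x = MulOpposite.op h • x ∧ MulOpposite.op (a l) • y = h • y := by
    rw [eq_comm]
    change q (c l • x, y) = q (x, MulOpposite.op (a l) • y) ↔ _
    exact Quotient.eq (r := prodSetoid X Y)
  let W : Set (X.carrier × Y.carrier) := {w | q w ∈ fixSet a c (X.comp Y)}
  have hq (h : H) (z : (X.comp Y).carrier) :
      q (MulOpposite.op h⁻¹ • (Quotient.out z).1, h • (Quotient.out z).2) = z := by
    conv_rhs => rw [← Quotient.out_eq z]
    exact Quotient.sound ⟨h⁻¹, rfl, by simp⟩
  -- The group `H` acts on `X × Y` by `(x h⁻¹, h y)`, freely because `Y` is left-free, and the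
  -- classes `[x, y]` are the orbits. Hence `W` has `|H|` points over each fixed class.
  let A : H × fixSet a c (X.comp Y) → W := fun s =>
    ⟨(MulOpposite.op s.1⁻¹ • (Quotient.out s.2.1).1, s.1 • (Quotient.out s.2.1).2),
      (congrArg (· ∈ fixSet a c (X.comp Y)) (hq s.1 s.2.1)).mpr s.2.2⟩
  have hqA (s) : q (A s).1 = s.2.1 := hq s.1 s.2.1
  have hA : Function.Bijective A := by
    constructor
    · intro s t e
      have e2 : s.2 = t.2 := Subtype.ext (by rw [← hqA, ← hqA, e])
      obtain ⟨s1, s2⟩ := s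
      obtain ⟨t1, t2⟩ := t
      obtain rfl : s2 = t2 := e2
      have e1 : s1 • (Quotient.out s2.1).2 = t1 • (Quotient.out s2.1).2 :=
        congrArg (fun w : W => w.1.2) e
      rw [smul_left_cancel_of_free Y e1]
    · rintro ⟨w, hw⟩
      obtain ⟨h, h1, h2⟩ := (prodSetoid X Y).iseqv.symm (Quotient.exact (Quotient.out_eq (q w)))
      refine ⟨(h⁻¹, ⟨q w, hw⟩), Subtype.ext (Prod.ext ?_ ?_)⟩
      · simp [A, h1]
      · simp [A, h2]
  -- If `[x, y]` is fixed, then for each `l` some `ρ(l)` satisfies `c(l) x = x ρ(l)` and `y a(l) =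
  -- ρ(l) y`. It is unique since `Y` is left-free, and uniqueness makes `ρ` a homomorphism.
  let B : (Σ ρ : L →* H, fixSet ρ c X × fixSet a ρ Y) → W := fun s =>
    ⟨(s.2.1.1, s.2.2.1), fun l =>
      (key _ _ l).mpr ⟨s.1 l, (s.2.1.2 l).symm, s.2.2.2 l⟩⟩
  have hB : Function.Bijective B := by
    constructor
    · rintro ⟨ρ, x, y⟩ ⟨ρ', x', y'⟩ e
      have ex : x.1 = x'.1 := congrArg (fun w : W => w.1.1) e
      have ey : y.1 = y'.1 := congrArg (fun w : W => w.1.2) e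
      obtain rfl : ρ = ρ' := MonoidHom.ext fun l => by
        refine smul_left_cancel_of_free Y (x := y.1) ?_
        rw [← y.2 l, ey, y'.2 l]
      obtain rfl : x = x' := Subtype.ext ex
      obtain rfl : y = y' := Subtype.ext ey
      rfl
    · rintro ⟨⟨x, y⟩, hw⟩
      choose ρ hx hy using fun l => (key x y l).mp (hw l)
      refine ⟨⟨MonoidHom.mk' ρ fun l m => smul_left_cancel_of_free Y (x := y) ?_,
        ⟨x, fun l => (hx l).symm⟩, ⟨y, fun l => hy l⟩⟩, rfl⟩
      rw [← hy, map_mul, MulOpposite.op_mul, mul_smul, hy l,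
        ← smul_comm (ρ l) (MulOpposite.op (a m)) y, hy m, smul_smul]
  have h1 := Nat.card_congr (Equiv.ofBijective A hA)
  have h2 := Nat.card_congr (Equiv.ofBijective B hB)
  rw [Nat.card_prod] at h1
  rw [Nat.card_sigma] at h2
  rw [fixCard, h1, ← h2]
  exact Finset.sum_congr rfl fun ρ _ => Nat.card_prod _ _

end LFBiset

/-! ## Finite sets with an action are determined by their fixed point counts -/

namespace MulAction

variable {M : Type*} [Group M]

/-- The complement of an orbit. -/
def orbitCompl {α : Type*} [MulAction M α] (x : α) : SubMulAction M α where
  carrier := {y | y ∉ orbit M x}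
  smul_mem' g y hy := by
    rintro ⟨k, hk⟩
    exact hy ⟨g⁻¹ * k, by
      change (g⁻¹ * k) • x = y
      rw [mul_smul, inv_smul_eq_iff]
      exact hk⟩

/-- Both orbits are copies of the coset space of the common stabilizer. -/
theorem exists_orbit_equiv {α β : Type*} [MulAction M α] [MulAction M β] {x : α} {y : β}
    (h : stabilizer M x = stabilizer M y) :
    ∃ e : orbit M x ≃ orbit M y, ∀ (g : M) (z : orbit M x), e (g • z) = g • e z := by
  refine ⟨(orbitEquivQuotientStabilizer M x).trans
    ((Subgroup.quotientEquivOfEq h).trans (orbitEquivQuotientStabilizer M y).symm), ?_⟩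
  rintro g ⟨_, k, rfl⟩
  have key (k : M) : ((orbitEquivQuotientStabilizer M x).trans
    ((Subgroup.quotientEquivOfEq h).trans (orbitEquivQuotientStabilizer M y).symm))
      ⟨k • x, k, rfl⟩ = ⟨k • y, k, rfl⟩ := by
    have : orbitEquivQuotientStabilizer M x ⟨k • x, k, rfl⟩ = (k : M ⧸ stabilizer M x) := by
      rw [← Equiv.eq_symm_apply]
      exact Subtype.ext (orbitEquivQuotientStabilizer_symm_apply M x k).symm
    rw [Equiv.trans_apply, this]
    exact Subtype.ext (orbitEquivQuotientStabilizer_symm_apply M y k)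
  have e1 : g • (⟨k • x, k, rfl⟩ : orbit M x) = ⟨(g * k) • x, g * k, rfl⟩ :=
    Subtype.ext (mul_smul g k x).symm
  change _ = g • _
  rw [e1]
  erw [key, key]
  exact Subtype.ext (mul_smul g k y)

theorem card_fixedPoints_congr {α β : Type*} [MulAction M α] [MulAction M β] (e : α ≃ β)
    (he : ∀ (g : M) (x : α), e (g • x) = g • e x) (D : Subgroup M) :
    Nat.card (fixedPoints D α) = Nat.card (fixedPoints D β) := by
  refine Nat.card_congr (e.subtypeEquiv fun x => ?_)
  refine forall_congr' fun d => ?_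
  change (d : M) • x = x ↔ (d : M) • e x = e x
  rw [← he, e.apply_eq_iff_eq]

theorem card_fixedPoints_eq_add {α : Type*} [Finite α] [MulAction M α] (x : α) (D : Subgroup M) :
    Nat.card (fixedPoints D α) =
      Nat.card (fixedPoints D (orbit M x)) + Nat.card (fixedPoints D (orbitCompl (M := M) x)) := by
  classical
  rw [← Nat.card_sum]
  let F : fixedPoints D (orbit M x) ⊕ fixedPoints D (orbitCompl (M := M) x) → fixedPoints D α :=
    Sum.elim (fun z => ⟨z.1.1, fun d => congrArg Subtype.val (z.2 d)⟩)
      (fun z => ⟨z.1.1, fun d => congrArg Subtype.val (z.2 d)⟩)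
  refine (Nat.card_congr (Equiv.ofBijective F ⟨?_, ?_⟩)).symm
  · rintro (z | z) (w | w) h
    · exact congrArg Sum.inl (Subtype.ext (Subtype.ext (congrArg (fun v => v.1) h)))
    · have h' : z.1.1 = w.1.1 := congrArg Subtype.val h
      exact absurd (h' ▸ z.1.2) w.1.2
    · have h' : z.1.1 = w.1.1 := congrArg Subtype.val h
      exact absurd (h'.symm ▸ w.1.2) z.1.2
    · exact congrArg Sum.inr (Subtype.ext (Subtype.ext (congrArg (fun v => v.1) h)))
  · rintro ⟨z, hz⟩
    by_cases hx : z ∈ orbit M x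
    · exact ⟨Sum.inl ⟨⟨z, hx⟩, fun d => Subtype.ext (hz d)⟩, rfl⟩
    · exact ⟨Sum.inr ⟨⟨z, hx⟩, fun d => Subtype.ext (hz d)⟩, rfl⟩

/-- If `x` has a stabilizer of maximal order among all points of `α` and `β`, then `β` has a point
with the same stabilizer. -/
theorem exists_stabilizer_eq [Finite M] {α β : Type*} [Finite α] [Finite β] [MulAction M α]
    [MulAction M β]
    (h : ∀ D : Subgroup M, Nat.card (fixedPoints D α) = Nat.card (fixedPoints D β)) (x : α)
    (hx : ∀ y : β, Nat.card (stabilizer M y) ≤ Nat.card (stabilizer M x)) :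
    ∃ y : β, stabilizer M x = stabilizer M y := by
  -- The stabilizer of `x` fixes `x`, hence also some `y` in `β`. The stabilizer of `y` contains it,
  -- and maximality forces equality.
  have : Nonempty (fixedPoints (stabilizer M x) α) := ⟨⟨x, fun d => d.2⟩⟩
  have h0 : 0 < Nat.card (fixedPoints (stabilizer M x) β) := by
    rw [← h]
    exact Nat.card_pos
  obtain ⟨y, hy⟩ := (Nat.card_pos_iff.mp h0).1
  exact ⟨y, Subgroup.eq_of_le_of_card_ge (fun d hd => hy ⟨d, hd⟩) (hx y)⟩

/-- Burnside's theorem: two finite sets with an action of a finite group `M` are isomorphic if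
every subgroup of `M` has equally many fixed points in both. -/
theorem exists_equiv_of_card_fixedPoints [Finite M] (n : ℕ) : ∀ {α β : Type u} [Finite α]
    [Finite β] [MulAction M α] [MulAction M β], Nat.card α = n →
    (∀ D : Subgroup M, Nat.card (fixedPoints D α) = Nat.card (fixedPoints D β)) →
    ∃ e : α ≃ β, ∀ (g : M) (x : α), e (g • x) = g • e x := by
  classical
  induction n using Nat.strong_induction_on with
  | _ n ih =>
  intro α β _ _ _ _ hn h
  have hcard : Nat.card α = Nat.card β := by
    have e (γ : Type u) [MulAction M γ] : Nat.card (fixedPoints (⊥ : Subgroup M) γ) = Nat.card γ :=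
      Nat.card_congr (Equiv.subtypeUnivEquiv fun x d => by
        obtain rfl : d = 1 := Subsingleton.elim _ _
        exact one_smul _ x)
    rw [← e α, ← e β, h]
  rcases isEmpty_or_nonempty α with hα | ⟨⟨x0⟩⟩
  · have hβ : IsEmpty β := by
      rw [← Finite.card_eq_zero_iff, ← hcard, Finite.card_eq_zero_iff]
      exact hα
    exact ⟨Equiv.equivOfIsEmpty α β, fun _ x => isEmptyElim x⟩
  -- A point of `α ⊕ β` with the largest stabilizer has a partner on the other side. The two orbits
  -- are isomorphic, so removing both keeps the fixed point counts equal.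
  obtain ⟨x, y, hxy⟩ : ∃ (x : α) (y : β), stabilizer M x = stabilizer M y := by
    let f : α ⊕ β → ℕ := Sum.elim (fun x => Nat.card (stabilizer M x))
      (fun y => Nat.card (stabilizer M y))
    have : Nonempty (α ⊕ β) := ⟨Sum.inl x0⟩
    obtain ⟨z, hz⟩ := Finite.exists_max f
    rcases z with x | y
    · obtain ⟨y, hy⟩ := exists_stabilizer_eq h x fun y => hz (Sum.inr y)
      exact ⟨x, y, hy⟩
    · obtain ⟨x, hx⟩ := exists_stabilizer_eq (fun D => (h D).symm) y fun x => hz (Sum.inl x)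
      exact ⟨x, y, hx.symm⟩
  obtain ⟨e1, he1⟩ := exists_orbit_equiv hxy
  have hlt : Nat.card (orbitCompl (M := M) x) < n := by
    rw [← hn]
    exact Finite.card_subtype_lt (x := x) fun hx => hx (mem_orbit_self x)
  obtain ⟨e2, he2⟩ := ih _ hlt (α := orbitCompl (M := M) x) (β := orbitCompl (M := M) y) rfl
    fun D => by
      have h1 := card_fixedPoints_eq_add x D
      rw [h D, card_fixedPoints_eq_add y D, card_fixedPoints_congr e1 he1 D] at h1
      exact (Nat.add_left_cancel h1).symm
  let e : α ≃ β := (Equiv.sumCompl (· ∈ orbit M x)).symm.trans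
    ((Equiv.sumCongr e1 e2).trans (Equiv.sumCompl (· ∈ orbit M y)))
  have h1 (z : orbit M x) : e z.1 = (e1 z).1 := by
    change ((Equiv.sumCongr e1 e2).trans (Equiv.sumCompl (· ∈ orbit M y)))
      ((Equiv.sumCompl (· ∈ orbit M x)).symm z.1) = _
    rw [Equiv.sumCompl_symm_apply_of_pos z.2]
    rfl
  have h2 (z : orbitCompl (M := M) x) : e z.1 = (e2 z).1 := by
    change ((Equiv.sumCongr e1 e2).trans (Equiv.sumCompl (· ∈ orbit M y)))
      ((Equiv.sumCompl (· ∈ orbit M x)).symm z.1) = _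
    rw [Equiv.sumCompl_symm_apply_of_neg z.2]
    rfl
  refine ⟨e, fun g z => ?_⟩
  by_cases hz : z ∈ orbit M x
  · have := h1 (g • ⟨z, hz⟩)
    rw [he1] at this
    exact this.trans (congrArg (g • ·) (h1 ⟨z, hz⟩).symm)
  · have := h2 (g • (⟨z, hz⟩ : orbitCompl (M := M) x))
    rw [he2] at this
    exact this.trans (congrArg (g • ·) (h2 ⟨z, hz⟩).symm)

end MulAction

/-! ### Bisets are determined by their marks; fixed left orbits modulo `p`. -/

namespace LFBiset

variable {G H : Type u} [Group G] [Group H]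

/-- The action of `H × Gᵐᵒᵖ` on a biset. -/
abbrev prodAction (X : LFBiset G H) : MulAction (H × Gᵐᵒᵖ) X.carrier where
  smul w x := w.1 • w.2 • x
  one_smul x := by
    change (1 : H) • (1 : Gᵐᵒᵖ) • x = x
    rw [one_smul, one_smul]
  mul_smul v w x := by
    change (v.1 * w.1) • (v.2 * w.2) • x = v.1 • v.2 • w.1 • w.2 • x
    rw [mul_smul, mul_smul, smul_comm w.1 v.2]

/-- A biset is determined up to isomorphism by the numbers `fixCard P.subtype φ X`, for `P ≤ G` and
`φ : P → H`. -/
theorem equiv_of_fixCard [Finite G] [Finite H] {X Y : LFBiset G H}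
    (h : ∀ (P : Subgroup G) (φ : P →* H), fixCard P.subtype φ X = fixCard P.subtype φ Y) :
    X ≈ Y := by
  -- If some `l` has `a l = 1` and `b l ≠ 1`, left freeness rules out fixed points. Otherwise `b`
  -- factors through the image of `a`, and the hypothesis applies there.
  have hgen (L : Type u) [Group L] (a : L →* G) (b : L →* H) : fixCard a b X = fixCard a b Y := by
    by_cases hk : a.ker ≤ b.ker
    · have hk' : a.rangeRestrict.ker ≤ b.ker := by rwa [MonoidHom.ker_rangeRestrict]
      let φ : a.range →* H :=
        a.rangeRestrict.liftOfSurjective a.rangeRestrict_surjective ⟨b, hk'⟩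
      have hb : φ.comp a.rangeRestrict = b := MonoidHom.ext fun l =>
        a.rangeRestrict.liftOfRightInverse_comp_apply _
          (Function.rightInverse_surjInv a.rangeRestrict_surjective) ⟨b, hk'⟩ l
      have := h a.range φ
      rw [← fixCard_comp_surjective _ _ _ a.rangeRestrict_surjective X,
        ← fixCard_comp_surjective _ _ _ a.rangeRestrict_surjective Y, hb] at this
      exact this
    · have hz (Z : LFBiset G H) : fixCard a b Z = 0 := by
        obtain ⟨l, hl, hl'⟩ := SetLike.not_le_iff_exists.mp hk
        have : IsEmpty (fixSet a b Z) := ⟨fun z => hl' (Z.left_free (b l) z.1 (by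
          rw [← z.2 l, MonoidHom.mem_ker.mp hl, MulOpposite.op_one, one_smul]))⟩
        exact Nat.card_of_isEmpty
      rw [hz, hz]
  let := X.prodAction
  let := Y.prodAction
  have : Finite (H × Gᵐᵒᵖ) :=
    Finite.of_equiv _ (Equiv.prodCongr (Equiv.refl H) (MulOpposite.opEquiv (α := G)))
  obtain ⟨e, he⟩ := MulAction.exists_equiv_of_card_fixedPoints (M := H × Gᵐᵒᵖ) _
    (α := X.carrier) (β := Y.carrier) rfl fun D => by
      -- The pair `(h, g)` fixes `z` when `h z g = z`, that is `z g⁻¹ = h z`. The inverse also makes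
      -- the projection to `Gᵐᵒᵖ` a homomorphism to `G`.
      let a : D →* G :=
        { toFun := fun d => d.1.2.unop⁻¹
          map_one' := by simp
          map_mul' := fun d d' => by simp }
      let b : D →* H := (MonoidHom.fst H Gᵐᵒᵖ).comp D.subtype
      have key (Z : LFBiset G H) (z : Z.carrier) :
          (letI := Z.prodAction; z ∈ MulAction.fixedPoints D Z.carrier) ↔ z ∈ fixSet a b Z := by
        refine forall_congr' fun d => ?_
        change d.1.1 • d.1.2 • z = z ↔ MulOpposite.op (d.1.2.unop⁻¹) • z = d.1.1 • z
        rw [MulOpposite.op_inv, MulOpposite.op_unop, inv_smul_eq_iff, smul_comm d.1.1, eq_comm]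
      exact (Nat.card_congr (Equiv.subtypeEquivRight (key X))).trans ((hgen D a b).trans
        (Nat.card_congr (Equiv.subtypeEquivRight (key Y))).symm)
  refine ⟨⟨e, fun k x => ?_, fun g x => ?_⟩⟩
  · have : e (k • (1 : Gᵐᵒᵖ) • x) = k • (1 : Gᵐᵒᵖ) • e x := he (k, 1) x
    simpa using this
  · have : e ((1 : H) • g • x) = (1 : H) • g • e x := he (1, g) x
    simpa using this

/-- The terminal `(H, 1)`-biset. -/
def terminal (H : Type u) [Group H] : LFBiset H PUnit.{u + 1} where
  carrier := PUnit.{u + 1}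
  comm := ⟨fun _ _ _ => rfl⟩
  left_free := fun _ _ _ => rfl

theorem card_eq_mul_orbitCount [Finite H] (X : LFBiset G H) :
    Nat.card X.carrier = Nat.card H * orbitCount X := by
  have e := MulAction.selfEquivOrbitsQuotientProd (G := H) (X := X.carrier) fun x => by
    rw [eq_bot_iff]
    exact fun h hh => X.left_free h x hh
  rw [Nat.card_congr e, Nat.card_prod, mul_comm]
  rfl

/-- If `L` is a `p`-group, then the number of left orbits of `X` fixed by `L` is congruent mod `p`
to the number of all left orbits. -/
theorem exists_sum_fixCard_eq {p : ℕ} [Fact p.Prime] [Finite H] {L : Type u} [Group L] [Finite L]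
    (hL : IsPGroup p L) [Fintype (L →* H)] (a : L →* G) (X : LFBiset G H) :
    ∃ n : ℕ, ∑ ρ : L →* H, fixCard a ρ X = Nat.card H * n ∧ n ≡ orbitCount X [MOD p] := by
  have hpt {L : Type u} [Group L] (ρ : L →* H) : fixCard ρ 1 (terminal H) = 1 := by
    have : Unique (fixSet ρ (1 : L →* PUnit) (terminal H)) :=
      ⟨⟨PUnit.unit, fun _ => rfl⟩, fun x => Subtype.ext (Subsingleton.elim (α := PUnit) x.1 _)⟩
    exact Nat.card_unique
  -- Composing the one-point biset with `X` gives the set of left orbits of `X`. All marks of the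
  -- point are `1`, so the formula for composites leaves the plain sum.
  have key {L : Type u} [Group L] [Fintype (L →* H)] (a : L →* G) :
      ∑ ρ : L →* H, fixCard a ρ X = Nat.card H * fixCard a 1 ((terminal H).comp X) := by
    rw [card_mul_fixCard_comp]
    exact Finset.sum_congr rfl fun ρ _ => by rw [hpt, one_mul]
  refine ⟨fixCard a 1 ((terminal H).comp X), key a, ?_⟩
  let Z := (terminal H).comp X
  have hone (x : Z.carrier) := @one_smul PUnit.{u + 1} Z.carrier _ Z.left x
  -- This is `key` for the trivial group `L`, where the only summand is the number of points of `X`.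
  have horb : orbitCount X = Nat.card ((terminal H).comp X).carrier := by
    let : Unique (PUnit.{u + 1} →* H) := ⟨⟨1⟩, fun f => MonoidHom.ext fun x => map_one f⟩
    let : Fintype (PUnit.{u + 1} →* H) := Unique.fintype
    have h1 := key (L := PUnit) (1 : PUnit →* G)
    have h2 : fixCard (1 : PUnit →* G) (1 : PUnit →* H) X = Nat.card X.carrier :=
      Nat.card_congr (Equiv.subtypeUnivEquiv fun x _ => by simp)
    have h3 : fixCard (1 : PUnit →* G) (1 : PUnit.{u + 1} →* PUnit.{u + 1})
        ((terminal H).comp X) = Nat.card ((terminal H).comp X).carrier :=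
      Nat.card_congr (Equiv.subtypeUnivEquiv fun x l => (one_smul _ x).trans (hone x).symm)
    rw [Fintype.sum_unique, h3] at h1
    refine Nat.eq_of_mul_eq_mul_left (Nat.card_pos (α := H)) ?_
    rw [← card_eq_mul_orbitCount, ← h2, ← h1]
    congr 1
  rw [horb]
  let act : MulAction Lᵐᵒᵖ ((terminal H).comp X).carrier :=
    MulAction.compHom _ (MonoidHom.op a)
  have hL' : IsPGroup p Lᵐᵒᵖ := hL.of_equiv (MulEquiv.inv' L)
  have := hL'.card_modEq_card_fixedPoints ((terminal H).comp X).carrier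
  refine Nat.ModEq.trans ?_ this.symm
  refine congrArg (· % p) (Nat.card_congr (Equiv.subtypeEquivRight fun x => ?_))
  change (∀ l, _ = _) ↔ ∀ l : Lᵐᵒᵖ, MulOpposite.op (a l.unop) • x = x
  exact ⟨fun h l => (h l.unop).trans (hone x),
    fun h l => (h (MulOpposite.op l)).trans (hone x).symm⟩

end LFBiset

/-! ## Marks on Burnside modules -/

noncomputable section

/-- The number `LFBiset.fixCard a b`, on isomorphism classes. -/
def BisetClass.fixCard {G H L : Type u} [Group G] [Group H] [Group L] (a : L →* G) (b : L →* H) :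
    BisetClass G H →+ ℤ where
  toFun := Quotient.lift (fun X => (LFBiset.fixCard a b X : ℤ))
    fun _ _ h => congrArg Nat.cast (LFBiset.fixCard_congr a b h)
  map_zero' := congrArg Nat.cast (LFBiset.fixCard_empty a b)
  map_add' := by
    rintro ⟨X⟩ ⟨Y⟩
    exact (congrArg Nat.cast (LFBiset.fixCard_sum a b X Y)).trans (Nat.cast_add _ _)

theorem Algebra.GrothendieckAddGroup.exists_eq_of_sub_of {M : Type*} [AddCommMonoid M]
    (x : Algebra.GrothendieckAddGroup M) :
    ∃ a b : M, x = Algebra.GrothendieckAddGroup.of a - Algebra.GrothendieckAddGroup.of b := by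
  induction x using AddLocalization.ind with
  | _ w =>
  obtain ⟨a, ⟨b, hb⟩⟩ := w
  refine ⟨a, b, ?_⟩
  rw [eq_sub_iff_add_eq]
  change AddLocalization.mk a ⟨b, hb⟩ + AddLocalization.mk b 0 = AddLocalization.mk a 0
  rw [AddLocalization.mk_add, AddLocalization.mk_eq_mk_iff, AddLocalization.r_iff_exists]
  exact ⟨0, by simp [add_comm]⟩

namespace Burnside

variable {G H : Type u} [Group G] [Group H]

/-- The mark of `(a, b)`: the additive extension of `LFBiset.fixCard a b`. -/
def mark {L : Type u} [Group L] (a : L →* G) (b : L →* H) : Burnside G H →+ ℤ :=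
  lift (BisetClass.fixCard a b)

theorem mark_ofBiset {L : Type u} [Group L] (a : L →* G) (b : L →* H) (X : LFBiset G H) :
    mark a b (ofBiset X) = LFBiset.fixCard a b X := lift_of _ _

theorem aug_ofBiset (X : LFBiset G H) : aug (ofBiset X) = LFBiset.orbitCount X := lift_of _ _

theorem exists_eq_sub (x : Burnside G H) : ∃ X Y : LFBiset G H, x = ofBiset X - ofBiset Y := by
  obtain ⟨⟨X⟩, ⟨Y⟩, h⟩ := Algebra.GrothendieckAddGroup.exists_eq_of_sub_of x
  exact ⟨X, Y, h⟩

/-- Marks detect elements of the Burnside module. -/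
theorem eq_zero_of_mark [Finite G] [Finite H] {x : Burnside G H}
    (h : ∀ (P : Subgroup G) (φ : P →* H), mark P.subtype φ x = 0) : x = 0 := by
  obtain ⟨X, Y, rfl⟩ := exists_eq_sub x
  have hXY : X ≈ Y := LFBiset.equiv_of_fixCard fun P φ => by
    have := h P φ
    rw [map_sub, mark_ofBiset, mark_ofBiset, sub_eq_zero] at this
    exact_mod_cast this
  rw [sub_eq_zero]
  exact congrArg of (Quotient.sound hXY)

end Burnside

namespace BurnsideLoc

variable {p : ℕ} [Fact p.Prime] {G H K : Type u} [Group G] [Group H] [Group K]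

/-- The mark of `(a, b)` on the `p`-localization of the Burnside module. -/
def mark {L : Type u} [Group L] (a : L →* G) (b : L →* H) : BurnsideLoc p G H →+ ZLoc p :=
  TensorProduct.liftAddHom
    ((AddMonoidHom.mul (R := ZLoc p)).compl₂
      ((Int.castAddHom (ZLoc p)).comp (Burnside.mark a b)))
    (fun n x y => by simp [mul_left_comm, mul_assoc])

theorem mark_tmul {L : Type u} [Group L] (a : L →* G) (b : L →* H) (r : ZLoc p)
    (X : Burnside G H) : mark a b (r ⊗ₜ[ℤ] X) = r * (Burnside.mark a b X : ZLoc p) := rfl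

/-- The element of `A(G, H)_(p)` given by a biset. -/
def ofBiset (p : ℕ) [Fact p.Prime] (X : LFBiset G H) : BurnsideLoc p G H :=
  (1 : ZLoc p) ⊗ₜ[ℤ] Burnside.ofBiset X

/-- Marks, augmentation and composition are linear over `ℤ_(p)`, so identities between them need
checking on bisets only. Formal differences are covered by the scalar `-1`. -/
theorem induction_on {C : BurnsideLoc p G H → Prop} (x : BurnsideLoc p G H)
    (biset : ∀ X, C (ofBiset p X)) (add : ∀ x y, C x → C y → C (x + y))
    (smul : ∀ (r : ZLoc p) (x), C x → C (r • x)) : C x := by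
  induction x using TensorProduct.induction_on with
  | zero => simpa using smul 0 _ (biset (LFBiset.empty G H))
  | add x y hx hy => exact add x y hx hy
  | tmul r x =>
    obtain ⟨X, Y, rfl⟩ := Burnside.exists_eq_sub x
    have : r ⊗ₜ[ℤ] (Burnside.ofBiset X - Burnside.ofBiset Y) =
        r • ofBiset p X + (-r) • ofBiset p Y := by
      rw [ofBiset, ofBiset, TensorProduct.smul_tmul', TensorProduct.smul_tmul', smul_eq_mul,
        smul_eq_mul, mul_one, mul_one, TensorProduct.tmul_sub, TensorProduct.neg_tmul,
        sub_eq_add_neg]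
    rw [this]
    exact add _ _ (smul _ _ (biset X)) (smul _ _ (biset Y))

theorem mark_ofBiset {L : Type u} [Group L] (a : L →* G) (b : L →* H) (X : LFBiset G H) :
    mark a b (ofBiset p X) = (LFBiset.fixCard a b X : ZLoc p) := by
  rw [ofBiset, mark_tmul, Burnside.mark_ofBiset, one_mul, Int.cast_natCast]

theorem aug_ofBiset (X : LFBiset G H) :
    aug (ofBiset p X) = (LFBiset.orbitCount X : ZLoc p) := by
  rw [ofBiset, aug_tmul, Burnside.aug_ofBiset, one_mul, Int.cast_natCast]

theorem mark_smul {L : Type u} [Group L] (a : L →* G) (b : L →* H) (r : ZLoc p)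
    (x : BurnsideLoc p G H) : mark a b (r • x) = r * mark a b x := by
  induction x using TensorProduct.induction_on with
  | zero => simp
  | add x y hx hy => rw [smul_add, map_add, map_add, hx, hy, mul_add]
  | tmul s x => rw [TensorProduct.smul_tmul', mark_tmul, mark_tmul, smul_eq_mul, mul_assoc]

theorem aug_smul (r : ZLoc p) (x : BurnsideLoc p G H) : aug (r • x) = r * aug x := by
  induction x using TensorProduct.induction_on with
  | zero => simp
  | add x y hx hy => rw [smul_add, map_add, map_add, hx, hy, mul_add]
  | tmul s x => rw [TensorProduct.smul_tmul', aug_tmul, aug_tmul, smul_eq_mul, mul_assoc]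

theorem comp_ofBiset (X : LFBiset H K) (Y : LFBiset G H) :
    comp (ofBiset p X) (ofBiset p Y) = ofBiset p (X.comp Y) := by
  rw [ofBiset, ofBiset, comp_tmul, Burnside.comp_ofBiset, one_mul, ofBiset]

theorem add_comp (x x' : BurnsideLoc p H K) (y : BurnsideLoc p G H) :
    comp (x + x') y = comp x y + comp x' y := by
  unfold comp
  rw [TensorProduct.add_tmul, map_add]
  exact map_add _ _ _

theorem comp_add (x : BurnsideLoc p H K) (y y' : BurnsideLoc p G H) :
    comp x (y + y') = comp x y + comp x y' := by
  unfold comp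
  rw [TensorProduct.tmul_add, map_add]
  exact map_add _ _ _

theorem zero_comp (y : BurnsideLoc p G H) : comp (0 : BurnsideLoc p H K) y = 0 := by
  unfold comp
  rw [TensorProduct.zero_tmul, map_zero]
  exact map_zero _

theorem comp_zero (x : BurnsideLoc p H K) : comp x (0 : BurnsideLoc p G H) = 0 := by
  unfold comp
  rw [TensorProduct.tmul_zero, map_zero]
  exact map_zero _

theorem smul_comp (r : ZLoc p) (x : BurnsideLoc p H K) (y : BurnsideLoc p G H) :
    comp (r • x) y = r • comp x y := by
  induction x using TensorProduct.induction_on with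
  | zero => rw [smul_zero, zero_comp, smul_zero]
  | add x x' hx hx' => rw [smul_add, add_comp, add_comp, hx, hx', smul_add]
  | tmul s x =>
    induction y using TensorProduct.induction_on with
    | zero => rw [comp_zero, comp_zero, smul_zero]
    | add y y' hy hy' => rw [comp_add, comp_add, hy, hy', smul_add]
    | tmul t y =>
      rw [TensorProduct.smul_tmul', comp_tmul, comp_tmul, TensorProduct.smul_tmul', smul_eq_mul,
        smul_eq_mul, mul_assoc]

theorem comp_smul (r : ZLoc p) (x : BurnsideLoc p H K) (y : BurnsideLoc p G H) :
    comp x (r • y) = r • comp x y := by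
  induction y using TensorProduct.induction_on with
  | zero => rw [smul_zero, comp_zero, smul_zero]
  | add x x' hx hx' => rw [smul_add, comp_add, comp_add, hx, hx', smul_add]
  | tmul s y =>
    induction x using TensorProduct.induction_on with
    | zero => rw [zero_comp, zero_comp, smul_zero]
    | add y y' hy hy' => rw [add_comp, add_comp, hy, hy', smul_add]
    | tmul t y =>
      rw [TensorProduct.smul_tmul', comp_tmul, comp_tmul, TensorProduct.smul_tmul', smul_eq_mul,
        smul_eq_mul, mul_left_comm]

theorem mark_comp_res {G' L : Type u} [Group G'] [Group L] [Finite G'] [Finite G] (f : G' →* G)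
    (a : L →* G') (b : L →* H) (x : BurnsideLoc p G H) :
    mark a b (comp x (res p f)) = mark (f.comp a) b x := by
  induction x using induction_on with
  | biset X =>
    rw [mark_ofBiset, ← LFBiset.fixCard_comp_res]
    exact (congrArg (mark a b) (comp_ofBiset _ _)).trans (mark_ofBiset _ _ _)
  | add x y hx hy => rw [add_comp, map_add, map_add, hx, hy]
  | smul r x hx => rw [smul_comp, mark_smul, mark_smul, hx]

theorem mark_tr_comp {H' L : Type u} [Group H'] [Group L] [Finite H'] [Finite H] (f : H' →* H)
    (hf : Function.Injective f) (a : L →* G) (b : L →* H') (x : BurnsideLoc p G H) :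
    mark a b (comp (tr p f hf) x) = mark a (f.comp b) x := by
  induction x using induction_on with
  | biset X =>
    rw [mark_ofBiset, ← LFBiset.fixCard_tr_comp X f hf]
    exact (congrArg (mark a b) (comp_ofBiset _ _)).trans (mark_ofBiset _ _ _)
  | add x y hx hy => rw [comp_add, map_add, map_add, hx, hy]
  | smul r x hx => rw [comp_smul, mark_smul, mark_smul, hx]

/-- With marks as matrix entries indexed by homomorphisms, composition is matrix multiplication up
to the factor `|H|`. This is what makes idempotency usable. -/
theorem card_mul_mark_comp [Finite H] {L : Type u} [Group L] [Fintype (L →* H)] (a : L →* G)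
    (c : L →* K) (x : BurnsideLoc p H K) (y : BurnsideLoc p G H) :
    (Nat.card H : ZLoc p) * mark a c (comp x y) = ∑ ρ : L →* H, mark ρ c x * mark a ρ y := by
  induction x using induction_on with
  | add x x' hx hx' =>
    simp only [add_comp, map_add, mul_add, add_mul, hx, hx', Finset.sum_add_distrib]
  | smul r x hx =>
    simp only [smul_comp, mark_smul, mul_left_comm _ r, hx, Finset.mul_sum, mul_assoc]
  | biset X =>
    induction y using induction_on with
    | add x x' hx hx' => simp only [comp_add, map_add, mul_add, hx, hx', Finset.sum_add_distrib]
    | smul r x hx => simp only [comp_smul, mark_smul, mul_left_comm _ r, hx, Finset.mul_sum]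
    | biset Y =>
      simp only [comp_ofBiset, mark_ofBiset]
      exact_mod_cast congrArg (Nat.cast (R := ZLoc p)) (LFBiset.card_mul_fixCard_comp X Y a c)

/-- For a `p`-group `L`, the marks of `(a, ρ)`, summed over all `ρ : L → H`, give a multiple of
the order of `H`, the quotient being congruent to the augmentation. -/
theorem exists_sum_mark_eq [Finite H] {L : Type u} [Group L] [Finite L] (hL : IsPGroup p L)
    [Fintype (L →* H)] (a : L →* G) (x : BurnsideLoc p G H) :
    ∃ ν : ZLoc p, ∑ ρ : L →* H, mark a ρ x = Nat.card H * ν ∧ (p : ZLoc p) ∣ aug x - ν := by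
  induction x using induction_on with
  | biset X =>
    obtain ⟨n, h1, h2⟩ := LFBiset.exists_sum_fixCard_eq hL a X
    refine ⟨n, ?_, ?_⟩
    · simp only [mark_ofBiset]
      exact_mod_cast congrArg (Nat.cast (R := ZLoc p)) h1
    · rw [aug_ofBiset]
      have := map_dvd (Int.castRingHom (ZLoc p)) (Nat.modEq_iff_dvd.mp h2)
      simpa using this
  | add x y hx hy =>
    obtain ⟨ν, h1, h2⟩ := hx
    obtain ⟨ν', h1', h2'⟩ := hy
    refine ⟨ν + ν', ?_, ?_⟩
    · simp only [map_add, Finset.sum_add_distrib, h1, h1', mul_add]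
    · rw [map_add, add_sub_add_comm]
      exact dvd_add h2 h2'
  | smul r x hx =>
    obtain ⟨ν, h1, h2⟩ := hx
    refine ⟨r * ν, ?_, ?_⟩
    · simp only [mark_smul, ← Finset.mul_sum, h1, mul_left_comm]
    · rw [aug_smul, ← mul_sub]
      exact h2.mul_left r

/-! ### Detection of elements by marks over `ℤ_(p)`. -/

instance : IsDomain (ZLoc p) :=
  IsLocalization.isDomain_localization (R := ℤ)
    (M := (Ideal.span {(p : ℤ)}).primeCompl) (Ideal.primeCompl_le_nonZeroDivisors _)

instance : CharZero (ZLoc p) :=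
  charZero_of_injective_algebraMap (R := ℤ) (IsLocalization.injective (ZLoc p)
    (M := (Ideal.span {(p : ℤ)}).primeCompl) (Ideal.primeCompl_le_nonZeroDivisors _))

/-- Every element has a multiple, by a unit, that comes from the Burnside module. -/
theorem exists_smul_eq_tmul (x : BurnsideLoc p G H) :
    ∃ (s : ZLoc p) (y : Burnside G H), IsUnit s ∧ s • x = (1 : ZLoc p) ⊗ₜ[ℤ] y := by
  have hmem (r : ZLoc p) : ∃ s n : ℤ, IsUnit (s : ZLoc p) ∧ (s : ZLoc p) * r = n := by
    obtain ⟨⟨n, s⟩, h⟩ := IsLocalization.surj (Ideal.span {(p : ℤ)}).primeCompl r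
    have hs := IsLocalization.map_units (ZLoc p) s
    refine ⟨s, n, by simpa using hs, by simpa [mul_comm] using h⟩
  have hint (n : ℤ) (y : Burnside G H) :
      (n : ZLoc p) ⊗ₜ[ℤ] y = (1 : ZLoc p) ⊗ₜ[ℤ] (n • y) := by
    rw [← TensorProduct.smul_tmul, zsmul_eq_mul, mul_one]
  suffices h : ∃ (s : ℤ) (y : Burnside G H), IsUnit (s : ZLoc p) ∧
      (s : ZLoc p) • x = (1 : ZLoc p) ⊗ₜ[ℤ] y from let ⟨s, y, h1, h2⟩ := h; ⟨s, y, h1, h2⟩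
  induction x using TensorProduct.induction_on with
  | zero => exact ⟨1, 0, by simp, by simp⟩
  | tmul r y =>
    obtain ⟨s, n, hs, h⟩ := hmem r
    exact ⟨s, n • y, hs, by rw [TensorProduct.smul_tmul', smul_eq_mul, h, hint]⟩
  | add x x' hx hx' =>
    obtain ⟨s, y, hs, h⟩ := hx
    obtain ⟨s', y', hs', h'⟩ := hx'
    refine ⟨s * s', s' • y + s • y', by simpa using ⟨hs, hs'⟩, ?_⟩
    rw [Int.cast_mul, smul_add, mul_comm, mul_smul, h, mul_comm, mul_smul, h',
      TensorProduct.smul_tmul', TensorProduct.smul_tmul', smul_eq_mul, smul_eq_mul, mul_one,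
      mul_one, hint, hint, TensorProduct.tmul_add]

/-- Marks detect elements of the localized Burnside module. -/
theorem ext_mark [Finite G] [Finite H] {x y : BurnsideLoc p G H}
    (h : ∀ (P : Subgroup G) (φ : P →* H), mark P.subtype φ x = mark P.subtype φ y) : x = y := by
  rw [← sub_eq_zero]
  obtain ⟨s, z, hs, hz⟩ := exists_smul_eq_tmul (x - y)
  -- After clearing denominators the marks of `z` are integers, and `ℤ` embeds in `ℤ_(p)`.
  have h0 : z = 0 := Burnside.eq_zero_of_mark fun P φ => by
    have h1 := congrArg (mark P.subtype φ) hz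
    rw [mark_smul, map_sub, h, sub_self, mul_zero, mark_tmul, one_mul] at h1
    exact_mod_cast h1.symm
  rwa [h0, TensorProduct.tmul_zero, hs.smul_eq_zero] at hz

/-- If the mark of `[P, φ]` at `(a, b)` is not zero, then `b` is `φ ∘ a` up to conjugation. -/
theorem exists_conj_of_mark_basis_ne_zero [Finite G] [Finite H] {P : Subgroup G} {φ : P →* H}
    {L : Type u} [Group L] {a : L →* G} {b : L →* H} (h : mark a b (basis p P φ) ≠ 0) :
    ∃ (g : G) (k : H) (hP : ∀ l, g * a l * g⁻¹ ∈ P),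
      ∀ l, b l = k * φ ⟨g * a l * g⁻¹, hP l⟩ * k⁻¹ := by
  have h1 : mark a b (basis p P φ) = (LFBiset.fixCard a b (LFBiset.trans P φ) : ZLoc p) :=
    mark_ofBiset a b _
  rw [h1, Nat.cast_ne_zero] at h
  have : Nonempty (LFBiset.fixSet a b (LFBiset.trans P φ)) := by
    by_contra hc
    rw [not_nonempty_iff] at hc
    exact h Nat.card_of_isEmpty
  obtain ⟨⟨⟨k, g⟩, hx⟩⟩ := this
  -- A fixed point `[k, g]` satisfies `[k, g a(l)] = [b(l) k, g]`. The element `u` that witnesses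
  -- this equality is the inverse of `g a(l) g⁻¹`.
  have key (l : L) : ∃ u : P, k = b l * k * φ u ∧ g = u * (g * a l) := Quotient.exact (hx l)
  have hu (l : L) (u : P) (e : g = u * (g * a l)) : g * a l * g⁻¹ = (u⁻¹ : P) := by
    rw [Subgroup.coe_inv, eq_inv_iff_mul_eq_one, ← eq_mul_inv_iff_mul_eq, one_mul,
      mul_inv_eq_iff_eq_mul, eq_inv_mul_iff_mul_eq]
    exact e.symm
  refine ⟨g, k, fun l => ?_, fun l => ?_⟩
  · obtain ⟨u, -, e⟩ := key l
    rw [hu l u e]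
    exact SetLike.coe_mem _
  · obtain ⟨u, e', e⟩ := key l
    have : (⟨g * a l * g⁻¹, by rw [hu l u e]; exact SetLike.coe_mem _⟩ : P) = u⁻¹ :=
      Subtype.ext (hu l u e)
    rw [this, map_inv, eq_mul_inv_iff_mul_eq, eq_mul_inv_iff_mul_eq]
    exact e'.symm

end BurnsideLoc

end

/-! ## Fusion systems as relations on injective homomorphisms -/

namespace FusionSystem

variable {S : Type u} [Group S] (F : FusionSystem S) {K L M : Type u} [Group K] [Group L] [Group M]

/-- `b = φ ∘ a` for a morphism `φ` of `F`, where `a` and `b` are injective homomorphisms to `S`. -/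
def Rel (a b : K →* S) : Prop :=
  ∃ (P : Subgroup S) (φ : P →* (⊤ : Subgroup S)) (i : K →* P), φ ∈ F.Hom P ⊤ ∧
    Function.Injective i ∧ P.subtype.comp i = a ∧ (amb φ).comp i = b

variable {F}

theorem inclusion_mem {P Q : Subgroup S} (h : P ≤ Q) : Subgroup.inclusion h ∈ F.Hom P Q :=
  F.conj_mem 1 _ fun u => by simp

/-- Morphisms do not depend on the target. -/
theorem mem_of_amb_eq {P Q Q' : Subgroup S} {φ : P →* Q} (hφ : φ ∈ F.Hom P Q) {χ : P →* Q'}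
    (h : amb φ = amb χ) : χ ∈ F.Hom P Q' := by
  have hinj : Function.Injective (amb χ) := h ▸ F.amb_injective hφ
  have hle : (amb χ).range ≤ Q' := by
    rintro _ ⟨u, rfl⟩
    exact (χ u).2
  have h1 := F.corestrict_mem hφ (MonoidHom.ofInjective hinj)
    fun u => (DFunLike.congr_fun h u).symm
  exact F.comp_mem h1 (inclusion_mem hle)

theorem rel_of_mem {P Q : Subgroup S} {φ : P →* Q} (hφ : φ ∈ F.Hom P Q) :
    F.Rel P.subtype (amb φ) :=
  ⟨P, (amb φ).codRestrict ⊤ fun _ => Subgroup.mem_top _, MonoidHom.id P, mem_of_amb_eq hφ rfl,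
    Function.injective_id, rfl, rfl⟩

namespace Rel

variable {a b c : K →* S}

theorem congr (h : F.Rel a b) {a' b' : K →* S} (ha : ∀ k, a k = a' k) (hb : ∀ k, b k = b' k) :
    F.Rel a' b' :=
  MonoidHom.ext ha ▸ MonoidHom.ext hb ▸ h

theorem injective_left (h : F.Rel a b) : Function.Injective a := by
  obtain ⟨P, φ, i, hφ, hi, rfl, rfl⟩ := h
  exact (Subgroup.subtype_injective P).comp hi

theorem injective_right (h : F.Rel a b) : Function.Injective b := by
  obtain ⟨P, φ, i, hφ, hi, rfl, rfl⟩ := h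
  exact (F.amb_injective hφ).comp hi

theorem precomp (h : F.Rel a b) {i : L →* K} (hi : Function.Injective i) :
    F.Rel (a.comp i) (b.comp i) := by
  obtain ⟨P, φ, j, hφ, hj, rfl, rfl⟩ := h
  exact ⟨P, φ, j.comp i, hφ, hj.comp hi, rfl, rfl⟩

/-- Surjectivity of `i` means that `a` and `b` determine `χ` on all of `P`. This turns the relation
back into membership in a set of morphisms. -/
theorem mem_hom (h : F.Rel a b) {P Q : Subgroup S} {χ : P →* Q} {i : K →* P}
    (hi : Function.Surjective i) (ha : P.subtype.comp i = a) (hb : (amb χ).comp i = b) :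
    χ ∈ F.Hom P Q := by
  obtain ⟨P', φ, j, hφ, -, hja, hjb⟩ := h
  have hle : P ≤ P' := by
    intro u hu
    obtain ⟨k, hk⟩ := hi ⟨u, hu⟩
    have : (j k : S) = u := by
      have := DFunLike.congr_fun (hja.trans ha.symm) k
      exact this.trans (congrArg Subtype.val hk)
    exact this ▸ (j k).2
  refine mem_of_amb_eq (F.comp_mem (inclusion_mem hle) hφ) (MonoidHom.ext fun u => ?_)
  obtain ⟨k, rfl⟩ := hi u
  have h1 : Subgroup.inclusion hle (i k) = j k :=
    Subtype.ext (DFunLike.congr_fun (ha.trans hja.symm) k)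
  have h2 : amb φ (j k) = amb χ (i k) := DFunLike.congr_fun (hjb.trans hb.symm) k
  rw [← h2, ← h1]
  rfl

theorem refl (ha : Function.Injective a) : F.Rel a a := by
  have h := rel_of_mem (F := F) (inclusion_mem (F := F) (le_refl a.range))
  exact h.precomp (i := a.rangeRestrict) fun x y e => ha (congrArg Subtype.val e)

theorem conj (ha : Function.Injective a) (g : S) : F.Rel a ((MulAut.conj g).toMonoidHom.comp a) := by
  have h := rel_of_mem (F := F) (P := a.range) (Q := ⊤)
    (φ := ((MulAut.conj g).toMonoidHom.comp a.range.subtype).codRestrict ⊤ fun _ => Subgroup.mem_top _)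
    (F.conj_mem g _ fun u => rfl)
  exact h.precomp (i := a.rangeRestrict) fun x y e => ha (congrArg Subtype.val e)

theorem mem_hom_subtype {P Q : Subgroup S} {χ : P →* Q} (h : F.Rel P.subtype (amb χ)) :
    χ ∈ F.Hom P Q :=
  h.mem_hom (i := MonoidHom.id P) Function.surjective_id rfl rfl

/-- The isomorphism between the images of two related homomorphisms. -/
theorem exists_equiv (h : F.Rel a b) : ∃ e : a.range ≃* b.range,
    (∀ k, (e (a.rangeRestrict k) : S) = b k) ∧ e.toMonoidHom ∈ F.Hom a.range b.range := by
  let e : a.range ≃* b.range := (MonoidHom.ofInjective h.injective_left).symm.trans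
    (MonoidHom.ofInjective h.injective_right)
  have he (k) : (e (a.rangeRestrict k) : S) = b k := by
    have : a.rangeRestrict k = MonoidHom.ofInjective h.injective_left k := rfl
    change (MonoidHom.ofInjective h.injective_right
      ((MonoidHom.ofInjective h.injective_left).symm (a.rangeRestrict k)) : S) = b k
    rw [this, MulEquiv.symm_apply_apply]
    rfl
  exact ⟨e, he, h.mem_hom a.rangeRestrict_surjective rfl (MonoidHom.ext he)⟩

theorem symm (h : F.Rel a b) : F.Rel b a := by
  obtain ⟨e, he, hm⟩ := h.exists_equiv
  have h1 := (rel_of_mem (F.symm_mem hm e fun _ => rfl)).precomp (i := b.rangeRestrict)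
    fun x y e => h.injective_right (congrArg Subtype.val e)
  refine h1.congr (fun k => rfl) fun k => ?_
  have : b.rangeRestrict k = e (a.rangeRestrict k) := Subtype.ext (he k).symm
  change (e.symm (b.rangeRestrict k) : S) = a k
  rw [this, e.symm_apply_apply]
  rfl

theorem trans (h : F.Rel a b) (h' : F.Rel b c) : F.Rel a c := by
  obtain ⟨e, he, hm⟩ := h.exists_equiv
  obtain ⟨e', he', hm'⟩ := h'.exists_equiv
  have h1 := (rel_of_mem (F.comp_mem hm hm')).precomp (i := a.rangeRestrict)
    fun x y e => h.injective_left (congrArg Subtype.val e)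
  refine h1.congr (fun k => rfl) fun k => ?_
  have : b.rangeRestrict k = e (a.rangeRestrict k) := Subtype.ext (he k).symm
  change (e' (e (a.rangeRestrict k)) : S) = c k
  rw [← this, he']

theorem isConj (h : F.Rel a b) : F.IsConj a.range b.range :=
  let ⟨e, _, hm⟩ := h.exists_equiv
  ⟨e, hm⟩

end Rel

theorem mem_aut_iff {P : Subgroup S} {e : MulAut P} :
    e ∈ F.aut P ↔ F.Rel P.subtype (P.subtype.comp (MulEquiv.toMonoidHom e)) :=
  ⟨fun h => rel_of_mem (φ := MulEquiv.toMonoidHom e) h,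
    fun h => Rel.mem_hom_subtype (χ := MulEquiv.toMonoidHom e) h⟩

theorem mem_autS_iff {P : Subgroup S} {e : MulAut P} :
    e ∈ autS P ↔ ∃ g ∈ Subgroup.normalizer (P : Set S), ∀ u : P, (e u : S) = g * u * g⁻¹ := by
  constructor
  · rintro ⟨g, rfl⟩
    exact ⟨g, g.2, fun u => rfl⟩
  · rintro ⟨g, hg, h⟩
    exact ⟨⟨g, hg⟩, MulEquiv.ext fun u => Subtype.ext (h u).symm⟩

theorem autS_le_aut (P : Subgroup S) : autS P ≤ F.aut P := by
  rintro e he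
  obtain ⟨g, -, h⟩ := mem_autS_iff.mp he
  exact F.conj_mem g _ h

/-! ### Consequences of saturation: fully normalized conjugates and extension to normalizers. -/

theorem isPGroup_autS {p : ℕ} (hS : IsPGroup p S) (P : Subgroup S) : IsPGroup p (autS P) :=
  (hS.to_subgroup _).of_surjective _ (MonoidHom.rangeRestrict_surjective _)

/-- Every subgroup is conjugate to a fully normalized one. -/
theorem exists_fullyNormalized [Finite S] (a : K →* S) (ha : Function.Injective a) :
    ∃ b : K →* S, F.Rel a b ∧ F.FullyNormalized b.range := by
  have : Finite K := Finite.of_injective a ha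
  have : Finite (K →* S) := DFunLike.finite _
  have : Nonempty {b : K →* S // F.Rel a b} := ⟨⟨a, Rel.refl ha⟩⟩
  obtain ⟨⟨b, hb⟩, hmax⟩ := Finite.exists_max fun b : {b : K →* S // F.Rel a b} =>
    Nat.card (Subgroup.normalizer (b.1.range : Set S))
  refine ⟨b, hb, ?_⟩
  rintro Q ⟨e, he⟩
  let c : K →* S := (amb e.toMonoidHom).comp b.rangeRestrict
  have hc : F.Rel b c := (rel_of_mem he).precomp (i := b.rangeRestrict)
    fun x y e => hb.injective_right (congrArg Subtype.val e)
  have hQ : c.range = Q := by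
    apply le_antisymm
    · rintro _ ⟨k, rfl⟩
      exact (e (b.rangeRestrict k)).2
    · intro q hq
      obtain ⟨k, hk⟩ := b.rangeRestrict_surjective (e.symm ⟨q, hq⟩)
      exact ⟨k, by simp [c, amb, hk]⟩
  have := hmax ⟨c, hb.trans hc⟩
  rwa [hQ] at this

/-- Extension of homomorphisms with fully centralized image. -/
theorem Saturated.exists_extend {p : ℕ} (hF : F.Saturated p) {P : Subgroup S} {b : P →* S}
    (h : F.Rel P.subtype b) (hb : F.FullyCentralized b.range) {N : Subgroup S}
    (hN : N ≤ extNormalizer b) (hP : P ≤ N) :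
    ∃ χ : N →* S, F.Rel N.subtype χ ∧ χ.comp (Subgroup.inclusion hP) = b := by
  have hφ : b.codRestrict ⊤ (fun _ => Subgroup.mem_top _) ∈ F.Hom P ⊤ := h.mem_hom_subtype
  obtain ⟨χ, hχ, he⟩ := hF.extend P _ hφ hb
  refine ⟨(amb χ).comp (Subgroup.inclusion hN),
    (rel_of_mem hχ).precomp (Subgroup.inclusion_injective hN), ?_⟩
  ext u
  exact congrArg Subtype.val (DFunLike.congr_fun he u)

/-- If `P'` is fully normalized, then every `F`-conjugate `P` of `P'` is taken to `P'` by a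
morphism defined on the normalizer of `P`. -/
theorem Saturated.exists_extend_normalizer {p : ℕ} [Fact p.Prime] [Finite S] (hS : IsPGroup p S)
    (hF : F.Saturated p) {P P' : Subgroup S} (hPP' : F.IsConj P P') (hP' : F.FullyNormalized P') :
    ∃ χ : Subgroup.normalizer (P : Set S) →* S,
      F.Rel (Subgroup.normalizer (P : Set S)).subtype χ ∧
        (χ.comp (Subgroup.inclusion Subgroup.le_normalizer : P →* _)).range = P' := by
  obtain ⟨e, he⟩ := hPP'
  obtain ⟨hcent, A, hA⟩ := hF.sylow P' hP'
  have heR := rel_of_mem he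
  -- `B` is `Aut_S(P)` carried over to `P'` by `e`. Being a `p`-group, it is conjugated by some `β ∈
  -- Aut_F(P')` into the Sylow subgroup `Aut_S(P')`. For `b = β ∘ e`, each conjugation by an element
  -- of `N_S(P)` then matches one by an element of `N_S(P')`, so `N_b` contains `N_S(P)`.
  let B : Subgroup (MulAut P') := (autS P).map (MulAut.congr e).toMonoidHom
  have hB : IsPGroup p (B.subgroupOf (F.aut P')) :=
    ((isPGroup_autS hS P).map _).comap_of_injective _ (Subgroup.subtype_injective _)
  obtain ⟨R, hR⟩ := hB.exists_le_sylow
  have : Finite (MulAut P') := Finite.of_injective (fun f : MulAut P' => (f : P' → P'))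
    DFunLike.coe_injective
  obtain ⟨β, hβ⟩ := MulAction.exists_smul_eq (F.aut P') R A
  let β' : MulAut P' := β
  let b : P →* S := P'.subtype.comp ((MulEquiv.toMonoidHom β').comp e.toMonoidHom)
  have hb (u : P) : b u = (β' (e u) : S) := rfl
  have hrel : F.Rel P.subtype b :=
    heR.trans ((mem_aut_iff.mp β.2).precomp (i := e.toMonoidHom) e.injective)
  have hrange : b.range = P' := by
    apply le_antisymm
    · rintro _ ⟨k, rfl⟩
      exact (β' (e k)).2
    · intro q hq
      exact ⟨e.symm (β'.symm ⟨q, hq⟩), by rw [hb]; simp⟩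
  have hN : Subgroup.normalizer (P : Set S) ≤ extNormalizer b := by
    intro x hx
    refine ⟨hx, ?_⟩
    let cx : MulAut P := P.normalizerMonoidHom ⟨x, hx⟩
    let d : MulAut P' := MulAut.congr e cx
    have hcx : cx ∈ autS P := ⟨⟨x, hx⟩, rfl⟩
    have hd : d ∈ F.aut P' := by
      rw [mem_aut_iff]
      have h1 := ((mem_aut_iff.mp (autS_le_aut (F := F) P hcx)).precomp (i := e.symm.toMonoidHom)
        e.symm.injective)
      have h2 := heR.precomp (i := e.symm.toMonoidHom) e.symm.injective
      have h3 := heR.precomp (i := (MulEquiv.toMonoidHom cx).comp e.symm.toMonoidHom)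
        (cx.injective.comp e.symm.injective)
      have h4 := (h2.symm.trans h1).trans h3
      refine h4.congr (fun u => ?_) fun u => rfl
      simp [amb]
    have hdR : (⟨d, hd⟩ : F.aut P') ∈ (R : Subgroup (F.aut P')) :=
      hR ⟨cx, hcx, rfl⟩
    have hdA : β * ⟨d, hd⟩ * β⁻¹ ∈ (A : Subgroup (F.aut P')) := by
      rw [← hβ, Sylow.smul_def]
      exact ⟨⟨d, hd⟩, hdR, rfl⟩
    rw [hA] at hdA
    obtain ⟨y, hy, h⟩ := mem_autS_iff.mp (Subgroup.mem_subgroupOf.mp hdA)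
    refine ⟨y, by rwa [hrange], fun u v huv => ?_⟩
    have h1 := h (β' (e u))
    have h2 : v = cx u := Subtype.ext huv
    rw [hb, hb, ← h1, h2]
    have h3 : β'⁻¹ (β' (e u)) = e u := β'.symm_apply_apply _
    change (β' (e (cx u)) : S) = (β' (d (β'⁻¹ (β' (e u)))) : S)
    rw [h3]
    simp [d]
  obtain ⟨χ, hχ, h⟩ := hF.exists_extend hrel (by rwa [hrange]) hN Subgroup.le_normalizer
  exact ⟨χ, hχ, by rw [h, hrange]⟩

end FusionSystem

/-! ## The Frattini property of normal subsystems -/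

/-- The intersection of a Sylow subgroup with a normal subgroup is a Sylow subgroup of it. -/
theorem Sylow.exists_eq_subgroupOf {p : ℕ} [Fact p.Prime] {G : Type*} [Group G] [Finite G]
    (A : Sylow p G) (N : Subgroup G) [N.Normal] :
    ∃ B : Sylow p N, (B : Subgroup N) = (A : Subgroup G).subgroupOf N := by
  have hp : IsPGroup p ((A : Subgroup G).subgroupOf N) :=
    A.2.comap_of_injective _ (Subgroup.subtype_injective _)
  obtain ⟨R, hR⟩ := hp.exists_le_sylow
  refine ⟨R, (Subgroup.eq_of_le_of_card_ge hR ?_).symm⟩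
  -- A conjugation taking `Q` to `A` takes `R` into `A ∩ N`, since `N` is normal. This bounds the
  -- order of `R`.
  obtain ⟨Q, hQ⟩ := (R.2.map N.subtype).exists_le_sylow
  obtain ⟨g, hg⟩ := MulAction.exists_smul_eq G Q A
  have hmem (r : R) : g * (r : N) * g⁻¹ ∈ (A : Subgroup G) := by
    rw [← hg, Sylow.smul_def]
    exact ⟨(r : N), hQ ⟨r, r.2, rfl⟩, rfl⟩
  have hN (r : R) : g * (r : N) * g⁻¹ ∈ N := Subgroup.Normal.conj_mem inferInstance _ (r : N).2 g
  refine Nat.card_le_card_of_injective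
    (fun r : R => (⟨⟨_, hN r⟩, hmem r⟩ : (A : Subgroup G).subgroupOf N)) fun r s h => ?_
  have h1 : g * (r : N) * g⁻¹ = g * (s : N) * g⁻¹ := congrArg (fun z => ((z.1 : N) : G)) h
  exact Subtype.ext (Subtype.ext (by simpa using h1))

/-- A form of the Frattini argument: for a normal subgroup `N` and a Sylow subgroup `A`, every
element is the product of an element of `N` and an element normalizing `A ∩ N`. -/
theorem Sylow.exists_mul_eq {p : ℕ} [Fact p.Prime] {G : Type*} [Group G] [Finite G]
    (A : Sylow p G) (N : Subgroup G) [N.Normal] (g : G) :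
    ∃ n ∈ N, ∃ h : G, g = n * h ∧ ∀ x ∈ (A : Subgroup G), x ∈ N → h * x * h⁻¹ ∈ (A : Subgroup G) := by
  obtain ⟨B, hB⟩ := A.exists_eq_subgroupOf N
  have hg : g ∈ N ⊔ Subgroup.normalizer (((B : Subgroup N).map N.subtype : Subgroup G) : Set G) := by
    rw [sup_comm, Sylow.normalizer_sup_eq_top B]
    trivial
  obtain ⟨n, hn, h, hh, rfl⟩ := Subgroup.mem_sup_of_normal_left.mp hg
  refine ⟨n, hn, h, rfl, fun x hxA hxN => ?_⟩
  have h1 := (Subgroup.mem_normalizer_iff.mp hh x).mp ⟨⟨x, hxN⟩, by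
    rw [hB]
    exact hxA, rfl⟩
  obtain ⟨y, hy, hy'⟩ := h1
  rw [hB] at hy
  rw [← hy']
  exact hy

/-! ### Normal subsystems and factorization through `Aut_F(T)`. -/

namespace FusionSystem

variable {S : Type u} [Group S] {F : FusionSystem S} {T : Subgroup S} {E : FusionSystem T}
  {K L M : Type u} [Group K] [Group L] [Group M]

theorem StronglyClosed.exists_lift (hT : F.StronglyClosed T) {a : K →* T} {b : K →* S}
    (h : F.Rel (T.subtype.comp a) b) : ∃ b' : K →* T, T.subtype.comp b' = b := by
  obtain ⟨e, he, hm⟩ := h.exists_equiv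
  have hle : (T.subtype.comp a).range ≤ T := by
    rintro _ ⟨k, rfl⟩
    exact (a k).2
  have h1 : (Subgroup.inclusion le_top).comp e.toMonoidHom ∈ F.Hom _ ⊤ :=
    F.comp_mem hm (inclusion_mem le_top)
  have h2 := hT _ hle _ h1
  refine ⟨b.codRestrict T fun k => h2 ⟨(T.subtype.comp a).rangeRestrict k, he k⟩, rfl⟩

theorem IsSubsystem.rel (hE : F.IsSubsystem E) {a b : K →* T} (h : E.Rel a b) :
    F.Rel (T.subtype.comp a) (T.subtype.comp b) := by
  obtain ⟨e, he, hm⟩ := h.exists_equiv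
  let r := a.range.equivMapOfInjective T.subtype T.subtype_injective
  have hi : Function.Injective (r.toMonoidHom.comp a.rangeRestrict) := fun x y e =>
    h.injective_left (congrArg Subtype.val (r.injective e))
  have h1 := (rel_of_mem (hE _ _ _ hm)).precomp hi
  refine h1.congr (fun k => rfl) fun k => ?_
  change (push e.toMonoidHom (r (a.rangeRestrict k)) : S) = b k
  rw [← he k]
  simp [push, r]

/-- The normality axiom is applied to the isomorphism `c(M) → d(M)` in `F`, with the images of `a`
and `b` as `A` and `B`. Stated through homomorphisms, it needs no bookkeeping of subgroups of `T`
and of `S`. -/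
theorem IsNormal.rel (hN : F.IsNormal E) {a b a' b' : K →* T} (h : E.Rel a b) {c d : M →* S}
    (h' : F.Rel c d) {a₀ b₀ : K →* M} (ha : T.subtype.comp a = c.comp a₀)
    (hb : T.subtype.comp b = c.comp b₀) (ha' : T.subtype.comp a' = d.comp a₀)
    (hb' : T.subtype.comp b' = d.comp b₀) : E.Rel a' b' := by
  obtain ⟨φ, hφ, hφm⟩ := h'.exists_equiv
  obtain ⟨θ, hθ, hθm⟩ := h.exists_equiv
  have inj {x x' : K →* T} {x₀ : K →* M} (hx : Function.Injective x)
      (e : T.subtype.comp x = c.comp x₀) (e' : T.subtype.comp x' = d.comp x₀) :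
      Function.Injective x' := by
    have h1 : Function.Injective x₀ := by
      refine Function.Injective.of_comp (f := c) ?_
      have : Function.Injective (T.subtype.comp x) := (Subgroup.subtype_injective T).comp hx
      rw [e] at this
      exact this
    refine Function.Injective.of_comp (f := T.subtype) ?_
    have : Function.Injective (d.comp x₀) := h'.injective_right.comp h1
    rw [← e'] at this
    exact this
  have hia' := inj h.injective_left ha ha'
  have hib' := inj h.injective_right hb hb'
  have hle {x : K →* T} {x₀ : K →* M} (e : T.subtype.comp x = c.comp x₀) :
      x.range.map T.subtype ≤ c.range := by
    rintro _ ⟨_, ⟨k, rfl⟩, rfl⟩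
    exact ⟨x₀ k, (DFunLike.congr_fun e k).symm⟩
  let eqv {x x' : K →* T} (hx : Function.Injective x) (hx' : Function.Injective x') :
    x.range ≃* x'.range := (MonoidHom.ofInjective hx).symm.trans (MonoidHom.ofInjective hx')
  have heqv {x x' : K →* T} (hx : Function.Injective x) (hx' : Function.Injective x') (k : K) :
      eqv hx hx' (x.rangeRestrict k) = x'.rangeRestrict k := by
    change MonoidHom.ofInjective hx' ((MonoidHom.ofInjective hx).symm
      (MonoidHom.ofInjective hx k)) = _
    rw [MulEquiv.symm_apply_apply]
    rfl
  have hval {x x' : K →* T} {x₀ : K →* M} (hx : Function.Injective x)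
      (hx' : Function.Injective x')
      (e : T.subtype.comp x = c.comp x₀) (e' : T.subtype.comp x' = d.comp x₀) (u : x.range) :
      ((eqv hx hx' u : T) : S) = φ ⟨u, hle e (Subgroup.mem_map_of_mem T.subtype u.2)⟩ := by
    obtain ⟨k, rfl⟩ := x.rangeRestrict_surjective u
    have h1 : (⟨x.rangeRestrict k, hle e (Subgroup.mem_map_of_mem T.subtype
        (x.rangeRestrict k).2)⟩ : c.range) = c.rangeRestrict (x₀ k) :=
      Subtype.ext (DFunLike.congr_fun e k)
    rw [h1, hφ, heqv]
    exact DFunLike.congr_fun e' k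
  have h1 := hN.conj_mem _ _ φ hφm a.range b.range a'.range b'.range (hle ha) (hle hb)
    (eqv h.injective_left hia') (eqv h.injective_right hib') (hval _ _ ha ha') (hval _ _ hb hb')
    _ hθm
  refine ((rel_of_mem h1).precomp (i := a'.rangeRestrict)
    fun x y e => hia' (congrArg Subtype.val e)).congr (fun k => rfl) fun k => ?_
  have h2 : (eqv h.injective_left hia').symm (a'.rangeRestrict k) = a.rangeRestrict k := by
    rw [MulEquiv.symm_apply_eq, heqv]
  have h3 : θ (a.rangeRestrict k) = b.rangeRestrict k := Subtype.ext (hθ k)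
  change ((eqv h.injective_right hib' (θ ((eqv h.injective_left hia').symm
    (a'.rangeRestrict k))) : b'.range) : T) = b' k
  rw [h2, h3, heqv]
  rfl

/-- `b = φ ∘ α ∘ a` for an automorphism `α` of `T` in `F` and a morphism `φ` of `E`. -/
def Factors (F : FusionSystem S) (E : FusionSystem T) (a b : K →* T) : Prop :=
  ∃ α ∈ F.aut T, E.Rel ((MulEquiv.toMonoidHom α).comp a) b

theorem IsNormal.rel_aut (hN : F.IsNormal E) {a b : K →* T} (h : E.Rel a b) {α : MulAut T}
    (hα : α ∈ F.aut T) :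
    E.Rel ((MulEquiv.toMonoidHom α).comp a) ((MulEquiv.toMonoidHom α).comp b) :=
  hN.rel h (mem_aut_iff.mp hα) rfl rfl rfl rfl

namespace Factors

variable {a b c : K →* T}

theorem of_rel (h : E.Rel a b) : Factors F E a b := ⟨1, one_mem _, h⟩

theorem precomp (h : Factors F E a b) {i : L →* K} (hi : Function.Injective i) :
    Factors F E (a.comp i) (b.comp i) :=
  let ⟨α, hα, h'⟩ := h
  ⟨α, hα, h'.precomp hi⟩

theorem symm (hN : F.IsNormal E) (h : Factors F E a b) : Factors F E b a := by
  obtain ⟨α, hα, h'⟩ := h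
  refine ⟨α⁻¹, inv_mem hα, (hN.rel_aut h' (inv_mem hα)).symm.congr (fun k => rfl) fun k => ?_⟩
  exact α.symm_apply_apply (a k)

/-- The automorphism `β` preserves `E`, so it moves past a morphism of `E`: `φ₂ β φ₁ α = φ₂ (β φ₁
β⁻¹) (β α)`. -/
theorem trans (hN : F.IsNormal E) (h : Factors F E a b) (h' : Factors F E b c) :
    Factors F E a c := by
  obtain ⟨α, hα, h1⟩ := h
  obtain ⟨β, hβ, h2⟩ := h'
  exact ⟨β * α, mul_mem hβ hα, ((hN.rel_aut h1 hβ).trans h2).congr (fun k => rfl) fun k => rfl⟩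

end Factors

/-- A `p`-group is nilpotent, so proper subgroups are smaller than their normalizers. This gives the
induction over orders a strictly larger domain. -/
theorem card_lt_card_normalizer {p : ℕ} [Fact p.Prime] [Finite S] (hS : IsPGroup p S)
    {P : Subgroup T} (hP : Nat.card P < Nat.card T) :
    Nat.card P < Nat.card (Subgroup.normalizer (P : Set T)) := by
  have := (hS.to_subgroup T).isNilpotent
  have h1 : P < ⊤ := by
    rw [lt_top_iff_ne_top]
    rintro rfl
    rw [Subgroup.card_top] at hP
    exact lt_irrefl _ hP
  exact Set.ncard_lt_ncard (Group.normalizerCondition_of_isNilpotent P h1)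

/-- Suppose that homomorphisms from groups larger than `K` factor. If `P'` is fully normalized and
conjugate to the image of `a`, then some `a'` with image `P'` is such that `(a, a')` factors. -/
theorem exists_factors_of_fullyNormalized {p : ℕ} [Fact p.Prime] [Finite S] (hS : IsPGroup p S)
    (hF : F.Saturated p) (hN : F.IsNormal E) (hK : Nat.card K < Nat.card T)
    (ih : ∀ (M : Type u) [Group M] (c d : M →* T), Nat.card K < Nat.card M →
      F.Rel (T.subtype.comp c) (T.subtype.comp d) → Factors F E c d)
    (a : K →* T) (ha : Function.Injective a) {P' : Subgroup S}
    (hP' : F.FullyNormalized P') (hc : F.IsConj (T.subtype.comp a).range P') :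
    ∃ a' : K →* T, (T.subtype.comp a').range = P' ∧ Factors F E a a' ∧
      F.Rel (T.subtype.comp a) (T.subtype.comp a') := by
  obtain ⟨χ, hχ, hr⟩ := hF.exists_extend_normalizer hS hc hP'
  have hcard : Nat.card a.range = Nat.card K := (Nat.card_congr (Equiv.ofInjective a ha)).symm
  have hle (n : Subgroup.normalizer (a.range : Set T)) :
      ((n : T) : S) ∈ Subgroup.normalizer ((T.subtype.comp a).range : Set S) := by
    rw [Subgroup.mem_normalizer_iff]
    intro x
    have hn := Subgroup.mem_normalizer_iff.mp n.2
    constructor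
    · rintro ⟨k, rfl⟩
      obtain ⟨k', hk'⟩ := (hn (a k)).mp ⟨k, rfl⟩
      exact ⟨k', congrArg Subtype.val hk'⟩
    · rintro ⟨k, hk⟩
      have hxT : x ∈ T := by
        have h1 : x = ((n : T) : S)⁻¹ * (a k : S) * ((n : T) : S) := by
          have : (a k : S) = (n : T) * x * ((n : T) : S)⁻¹ := hk
          rw [this]
          group
        rw [h1]
        exact mul_mem (mul_mem (inv_mem (n : T).2) (a k).2) (n : T).2
      obtain ⟨k', hk'⟩ := (hn ⟨x, hxT⟩).mpr ⟨k, Subtype.ext hk⟩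
      exact ⟨k', congrArg Subtype.val hk'⟩
  -- The map `χ` is restricted to the normalizer of `a(K)` in `T`. This is larger than `a(K)`, so
  -- the restriction factors by induction, and the factorization is restricted back to `K`.
  let j := (Subgroup.normalizer (a.range : Set T)).subtype
  let i : Subgroup.normalizer (a.range : Set T) →*
      Subgroup.normalizer ((T.subtype.comp a).range : Set S) :=
    (T.subtype.comp j).codRestrict _ hle
  have hi : Function.Injective i := fun x y e =>
    Subtype.ext (Subtype.ext (congrArg (fun z => z.1) e))
  have hrel := hχ.precomp hi
  obtain ⟨d, hd⟩ := hN.stronglyClosed.exists_lift (a := j) hrel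
  have hfac : Factors F E j d := by
    refine ih _ j d ?_ ?_
    · rw [← hcard]
      exact card_lt_card_normalizer hS (by rwa [hcard])
    · rw [hd]
      exact hrel
  let i₀ : K →* Subgroup.normalizer (a.range : Set T) :=
    (Subgroup.inclusion Subgroup.le_normalizer).comp a.rangeRestrict
  have hi₀ : Function.Injective i₀ := fun x y e => ha (congrArg (fun z => z.1) e)
  refine ⟨d.comp i₀, ?_, hfac.precomp hi₀, ?_⟩
  · rw [← hr, ← MonoidHom.comp_assoc, hd]
    ext x
    constructor
    · rintro ⟨k, rfl⟩
      exact ⟨⟨_, k, rfl⟩, rfl⟩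
    · rintro ⟨⟨_, k, rfl⟩, rfl⟩
      exact ⟨k, rfl⟩
  · have := hrel.precomp hi₀
    rw [← hd] at this
    exact this

/-- The Frattini property, for automorphisms of a fully normalized subgroup. -/
theorem factors_of_mem_aut {p : ℕ} [Fact p.Prime] [Finite S] (hS : IsPGroup p S)
    (hF : F.Saturated p) (hN : F.IsNormal E) {P : Subgroup S} (hP : F.FullyNormalized P)
    (hPT : P ≤ T) (hcard : Nat.card P < Nat.card T)
    (ih : ∀ (M : Type u) [Group M] (c d : M →* T), Nat.card P < Nat.card M →
      F.Rel (T.subtype.comp c) (T.subtype.comp d) → Factors F E c d)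
    {γ : MulAut P} (hγ : γ ∈ F.aut P) :
    Factors F E (Subgroup.inclusion hPT)
      ((Subgroup.inclusion hPT).comp (MulEquiv.toMonoidHom γ)) := by
  set j := Subgroup.inclusion hPT
  have hj : Function.Injective j := Subgroup.inclusion_injective hPT
  obtain ⟨hcent, A, hA⟩ := hF.sylow P hP
  -- `AE` is `Aut_E(P)`.
  let AE : Subgroup (F.aut P) :=
    { carrier := {e | E.Rel j (j.comp (MulEquiv.toMonoidHom e.1))}
      one_mem' := Rel.refl hj
      mul_mem' := fun {e f} he hf => (hf.trans (he.precomp (i := MulEquiv.toMonoidHom f.1)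
        f.1.injective)).congr (fun k => rfl) fun k => rfl
      inv_mem' := fun {e} he => (he.precomp (i := MulEquiv.toMonoidHom e.1⁻¹)
        (MulEquiv.injective _)).symm.congr
          (fun k => congrArg j (MulEquiv.apply_symm_apply e.1 k)) fun k => rfl }
  have hAE : AE.Normal := ⟨fun e he g => by
    have h1 : E.Rel (j.comp (MulEquiv.toMonoidHom g.1))
        (j.comp (MulEquiv.toMonoidHom (g.1 * e.1))) :=
      hN.rel he (mem_aut_iff.mp g.2) (a₀ := MonoidHom.id P) (b₀ := MulEquiv.toMonoidHom e.1)
        rfl rfl rfl rfl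
    exact (h1.precomp (i := MulEquiv.toMonoidHom g.1⁻¹) (MulEquiv.injective _)).congr
      (fun k => congrArg j (MulEquiv.apply_symm_apply g.1 k)) fun k => rfl⟩
  have : Finite (MulAut P) := Finite.of_injective (fun f : MulAut P => (f : P → P))
    DFunLike.coe_injective
  -- The factor `ε` lies in `Aut_E(P)`, so only `δ` has to be treated. It conjugates `Aut_S(P) ∩
  -- Aut_E(P)`, which contains the automorphisms induced by `N_T(P)`, into `Aut_S(P)`. Hence
  -- `N_T(P)` lies in the extension subgroup of `δ`, and the induction hypothesis applies to an
  -- extension.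
  obtain ⟨ε, hε, δ, hγδ, hδ⟩ := A.exists_mul_eq AE ⟨γ, hγ⟩
  have hγδ' : γ = ε.1 * δ.1 := congrArg Subtype.val hγδ
  let NT : Subgroup S := Subgroup.normalizer (P : Set S) ⊓ T
  have hPN : P ≤ NT := le_inf Subgroup.le_normalizer hPT
  let b : P →* S := P.subtype.comp (MulEquiv.toMonoidHom δ.1)
  have hb : F.Rel P.subtype b := mem_aut_iff.mp δ.2
  have hrange : b.range = P := by
    apply le_antisymm
    · rintro _ ⟨k, rfl⟩
      exact (δ.1 k).2
    · intro q hq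
      exact ⟨δ.1.symm ⟨q, hq⟩, congrArg Subtype.val (MulEquiv.apply_symm_apply δ.1 ⟨q, hq⟩)⟩
  have hext : NT ≤ extNormalizer b := by
    rintro x ⟨hx, hxT⟩
    refine ⟨hx, ?_⟩
    let cx : MulAut P := P.normalizerMonoidHom ⟨x, hx⟩
    have hcx : cx ∈ autS P := ⟨⟨x, hx⟩, rfl⟩
    let cx' : F.aut P := ⟨cx, autS_le_aut P hcx⟩
    have h1 : cx' ∈ AE := (Rel.conj hj ⟨x, hxT⟩).congr (fun k => rfl) fun k => rfl
    have h2 : cx' ∈ (A : Subgroup (F.aut P)) := by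
      rw [hA]
      exact hcx
    have h3 := hδ cx' h2 h1
    rw [hA] at h3
    obtain ⟨y, hy, h⟩ := mem_autS_iff.mp (Subgroup.mem_subgroupOf.mp h3)
    refine ⟨y, by rwa [hrange], fun u v huv => ?_⟩
    have h4 : v = cx u := Subtype.ext huv
    have h5 := h (δ.1 u)
    have h6 : δ.1⁻¹ (δ.1 u) = u := δ.1.symm_apply_apply _
    change ((δ.1 (cx (δ.1⁻¹ (δ.1 u))) : P) : S) = _ at h5
    rw [h6] at h5
    rw [h4]
    exact h5
  obtain ⟨χ, hχ, hχb⟩ := hF.exists_extend hb (by rwa [hrange]) hext hPN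
  let jN : NT →* T := Subgroup.inclusion inf_le_right
  obtain ⟨d, hd⟩ := hN.stronglyClosed.exists_lift (a := jN) hχ
  have hlt : Nat.card P < Nat.card NT := by
    let P₀ : Subgroup T := P.subgroupOf T
    have h1 : Nat.card P₀ = Nat.card P := Nat.card_congr (Subgroup.subgroupOfEquivOfLe hPT).toEquiv
    have h2 := card_lt_card_normalizer hS (P := P₀) (by rwa [h1])
    rw [h1] at h2
    refine h2.trans_le (Nat.card_le_card_of_injective
      (fun n : Subgroup.normalizer (P₀ : Set T) => (⟨((n : T) : S), ?_, (n : T).2⟩ : NT))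
      fun x y e => Subtype.ext (Subtype.ext (congrArg (fun z => z.1) e)))
    have hn := Subgroup.mem_normalizer_iff.mp n.2
    refine Subgroup.mem_normalizer_iff.mpr fun x => ⟨fun hx => ?_, fun hx => ?_⟩
    · exact (hn ⟨x, hPT hx⟩).mp hx
    · have hxT : x ∈ T := by
        have h1 : x = ((n : T) : S)⁻¹ * ((n : T) * x * ((n : T) : S)⁻¹) * ((n : T) : S) := by
          group
        rw [h1]
        exact mul_mem (mul_mem (inv_mem (n : T).2) (hPT hx)) (n : T).2
      exact (hn ⟨x, hxT⟩).mpr hx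
  have hfac : Factors F E jN d := ih _ jN d hlt (by rw [hd]; exact hχ)
  have h1 : Factors F E j (j.comp (MulEquiv.toMonoidHom δ.1)) := by
    have h2 := hfac.precomp (Subgroup.inclusion_injective hPN)
    have h3 : d.comp (Subgroup.inclusion hPN) = j.comp (MulEquiv.toMonoidHom δ.1) := by
      ext u
      have e1 := DFunLike.congr_fun hd (Subgroup.inclusion hPN u)
      have e2 := DFunLike.congr_fun hχb u
      exact e1.trans e2
    rw [h3] at h2
    exact h2
  refine h1.trans hN (.of_rel ?_)
  rw [hγδ']
  exact hε.precomp (i := MulEquiv.toMonoidHom δ.1) δ.1.injective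

/-- The Frattini property of a normal subsystem `E` on `T`: every morphism of `F` between subgroups
of `T` is the composite of an automorphism of `T` in `F` and a morphism of `E`. -/
theorem IsNormal.factors {p : ℕ} [Fact p.Prime] [Finite S] (hS : IsPGroup p S)
    (hF : F.Saturated p) (hN : F.IsNormal E) (n : ℕ) : ∀ {K : Type u} [Group K] {a b : K →* T},
    Nat.card T - Nat.card K = n → F.Rel (T.subtype.comp a) (T.subtype.comp b) →
      Factors F E a b := by
  induction n using Nat.strong_induction_on with
  | _ n ih =>
  intro K _ a b hn h
  have hia : Function.Injective a := Function.Injective.of_comp (f := T.subtype) h.injective_left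
  have hib : Function.Injective b := Function.Injective.of_comp (f := T.subtype) h.injective_right
  have hle : Nat.card K ≤ Nat.card T := Nat.card_le_card_of_injective a hia
  -- In the base case `a` and `b` are isomorphisms onto `T`, and `b ∘ a⁻¹` itself is the
  -- automorphism of `T`.
  rcases hle.eq_or_lt with hcard | hcard
  · have hbij {x : K →* T} (hx : Function.Injective x) : Function.Bijective x :=
      (Nat.bijective_iff_injective_and_card _).mpr ⟨hx, hcard⟩
    let ea := MulEquiv.ofBijective a (hbij hia)
    let eb := MulEquiv.ofBijective b (hbij hib)
    let α : MulAut T := ea.symm.trans eb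
    have hα (k : K) : α (a k) = b k := congrArg eb (ea.symm_apply_apply k)
    refine ⟨α, mem_aut_iff.mpr ((h.precomp (i := ea.symm.toMonoidHom) ea.symm.injective).congr
      (fun t => congrArg Subtype.val (ea.apply_symm_apply t)) fun t => rfl), ?_⟩
    have : (MulEquiv.toMonoidHom α).comp a = b := MonoidHom.ext hα
    rw [this]
    exact Rel.refl hib
  have ih' (M : Type u) [Group M] (c d : M →* T) (hM : Nat.card K < Nat.card M)
      (h : F.Rel (T.subtype.comp c) (T.subtype.comp d)) : Factors F E c d := by
    refine ih _ ?_ rfl h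
    have : Nat.card M ≤ Nat.card T := Nat.card_le_card_of_injective c
      (Function.Injective.of_comp (f := T.subtype) h.injective_left)
    omega
  -- Both `a` and `b` are moved to homomorphisms with one and the same fully normalized image, so
  -- that only an automorphism `γ` of that image remains.
  obtain ⟨f, hf, hfn⟩ := exists_fullyNormalized (F := F) _ h.injective_left
  obtain ⟨a', ha', haf, har⟩ :=
    exists_factors_of_fullyNormalized hS hF hN hcard ih' a hia hfn hf.isConj
  obtain ⟨b', hb', hbf, hbr⟩ :=
    exists_factors_of_fullyNormalized hS hF hN hcard ih' b hib hfn (h.symm.trans hf).isConj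
  refine haf.trans hN (Factors.trans hN ?_ (hbf.symm hN))
  have hab := (har.symm.trans h).trans hbr
  have hPT : f.range ≤ T := by
    rw [← ha']
    rintro _ ⟨k, rfl⟩
    exact (a' k).2
  have hequiv {x : K →* T} (hx : Function.Injective (T.subtype.comp x))
      (hr : (T.subtype.comp x).range = f.range) :
      ∃ e : K ≃* f.range, ∀ k, Subgroup.inclusion hPT (e k) = x k :=
    ⟨(MonoidHom.ofInjective hx).trans (MulEquiv.subgroupCongr hr), fun k => rfl⟩
  obtain ⟨ea, hea⟩ := hequiv hab.injective_left ha'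
  obtain ⟨eb, heb⟩ := hequiv hab.injective_right hb'
  let γ : MulAut f.range := ea.symm.trans eb
  have hγ : γ ∈ F.aut f.range :=
    mem_aut_iff.mpr ((hab.precomp (i := ea.symm.toMonoidHom) ea.symm.injective).congr
      (fun t => by
        refine (congrArg Subtype.val (hea (ea.symm t))).symm.trans ?_
        rw [ea.apply_symm_apply]
        rfl) fun t => (congrArg Subtype.val (heb (ea.symm t))).symm)
  have hcardP : Nat.card f.range = Nat.card K := (Nat.card_congr ea.toEquiv).symm
  have key := (factors_of_mem_aut hS hF hN hfn hPT (by rwa [hcardP]) (by rwa [hcardP]) hγ).precomp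
    (i := ea.toMonoidHom) ea.injective
  have e1 : (Subgroup.inclusion hPT).comp ea.toMonoidHom = a' := MonoidHom.ext hea
  have e2 : ((Subgroup.inclusion hPT).comp (MulEquiv.toMonoidHom γ)).comp ea.toMonoidHom = b' :=
    MonoidHom.ext fun k => (congrArg (fun z => Subgroup.inclusion hPT (eb z))
      (ea.symm_apply_apply k)).trans (heb k)
  rwa [e1, e2] at key

end FusionSystem

/-! ## Marks of characteristic idempotents -/

namespace FusionSystem

open BurnsideLoc

variable {p : ℕ} [Fact p.Prime] {S : Type u} [Group S] [Finite S] {E : FusionSystem S}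
  {K : Type u} [Group K] {ω : BurnsideLoc p S S}

/-- A nonzero mark of a generator `[P, φ]` at `(a, b)` makes `b` equal to `φ ∘ a` up to conjugation
before and after `φ`, and conjugations belong to `E`. Vanishing of a mark passes to the span. -/
theorem Generated.rel_of_mark_ne_zero (hω : E.Generated ω) {a b : K →* S}
    (ha : Function.Injective a) (h : mark a b ω ≠ 0) : E.Rel a b := by
  by_contra hr
  refine h (Submodule.span_induction (p := fun x _ => mark a b x = 0) ?_ (map_zero _) ?_ ?_ hω)
  · rintro _ ⟨P, φ, hφ, rfl⟩
    by_contra hne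
    obtain ⟨g, k, hP, hb⟩ := exists_conj_of_mark_basis_ne_zero hne
    refine hr ?_
    let i : K →* P := ((MulAut.conj g).toMonoidHom.comp a).codRestrict P hP
    have h1 : E.Rel a (P.subtype.comp i) := Rel.conj ha g
    have h2 : E.Rel (P.subtype.comp i) ((amb φ).comp i) := (rel_of_mem hφ).precomp
      (Function.Injective.of_comp (f := P.subtype) h1.injective_right)
    exact ((h1.trans h2).trans (Rel.conj h2.injective_right k)).congr (fun _ => rfl)
      fun l => (hb l).symm
  · intro x y _ _ hx hy
    rw [map_add, hx, hy, add_zero]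
  · intro r x _ hx
    rw [mark_smul, hx, mul_zero]

/-- Composing with `[φ(P), φ⁻¹]` or `[P, 1]` on the left puts `φ` or the inclusion into the second
argument of the mark, so this is the stability axiom read on marks. -/
theorem LeftStable.mark_eq (hω : E.LeftStable ω) (a : K →* S) {b b' : K →* S} (h : E.Rel b b') :
    mark a b ω = mark a b' ω := by
  obtain ⟨P, φ, i, hφ, -, rfl, rfl⟩ := h
  have := congrArg (mark a i) (hω P φ hφ)
  rw [mark_tr_comp, mark_tr_comp] at this
  exact this.symm

theorem RightStable.mark_eq (hω : E.RightStable ω) {a a' : K →* S} (b : K →* S)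
    (h : E.Rel a a') : mark a b ω = mark a' b ω := by
  obtain ⟨P, φ, i, hφ, -, rfl, rfl⟩ := h
  have := congrArg (mark i b) (hω P φ hφ)
  rw [mark_comp_res, mark_comp_res] at this
  exact this.symm

namespace IsCharIdempotent

/-- If this mark were zero, left stability would make the marks at all `(a, ρ)` zero. Their sum is
`|S| ν` with `ν` congruent mod `p` to the augmentation, so `p` would divide the augmentation. -/
theorem mark_self_ne_zero (hω : E.IsCharIdempotent ω) (hS : IsPGroup p S) {a : K →* S}
    (ha : Function.Injective a) :
    mark a a ω ≠ 0 := by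
  intro h
  have : Finite K := Finite.of_injective a ha
  have : Finite (K →* S) := DFunLike.finite _
  let := Fintype.ofFinite (K →* S)
  obtain ⟨ν, h1, h2⟩ := exists_sum_mark_eq (hS.of_injective a ha) a ω
  have h3 : ∑ ρ : K →* S, mark a ρ ω = 0 := Finset.sum_eq_zero fun ρ _ => by
    by_contra hne
    have hr := hω.generated.rel_of_mark_ne_zero ha hne
    rw [← hω.leftStable.mark_eq a hr] at hne
    exact hne h
  rw [h3, eq_comm, mul_eq_zero] at h1
  have hν : ν = 0 := h1.resolve_left (Nat.cast_ne_zero.mpr Nat.card_pos.ne')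
  rw [hν, sub_zero] at h2
  exact hω.aug_prime h2

/-- The mark at `(a, a)` is the order of `S` divided by the number of `E`-conjugates of `a`. -/
theorem card_eq_mul_mark (hω : E.IsCharIdempotent ω) (hS : IsPGroup p S) {a : K →* S}
    (ha : Function.Injective a) :
    (Nat.card S : ZLoc p) = Nat.card {ρ : K →* S // E.Rel a ρ} * mark a a ω := by
  classical
  have : Finite K := Finite.of_injective a ha
  have : Finite (K →* S) := DFunLike.finite _
  let := Fintype.ofFinite (K →* S)
  -- The diagonal entry of `ω ∘ ω = ω`: with `m` the mark at `(a, a)` and `n` the number of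
  -- conjugates, it reads `|S| m = n m²`, and `m` is cancelled.
  have h1 := card_mul_mark_comp a a ω ω
  have h2 (ρ : K →* S) : mark ρ a ω * mark a ρ ω =
      if E.Rel a ρ then mark a a ω * mark a a ω else 0 := by
    split_ifs with hr
    · rw [← hω.rightStable.mark_eq a hr, ← hω.leftStable.mark_eq a hr]
    · have : mark a ρ ω = 0 := by
        by_contra hne
        exact hr (hω.generated.rel_of_mark_ne_zero ha hne)
      rw [this, mul_zero]
  rw [hω.idem, Finset.sum_congr rfl fun ρ _ => h2 ρ, ← Finset.sum_filter, Finset.sum_const,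
    nsmul_eq_mul, ← mul_assoc] at h1
  rw [mul_right_cancel₀ (hω.mark_self_ne_zero hS ha) h1, Nat.card_eq_fintype_card,
    Fintype.card_subtype]

/-- The marks are invariant under automorphisms of `S` that preserve `E`. -/
theorem mark_aut (hω : E.IsCharIdempotent ω) (hS : IsPGroup p S)
    (α : MulAut S)
    (hα : ∀ {a b : K →* S}, E.Rel a b →
      E.Rel ((MulEquiv.toMonoidHom α).comp a) ((MulEquiv.toMonoidHom α).comp b))
    (hα' : ∀ {a b : K →* S}, E.Rel a b →
      E.Rel ((MulEquiv.toMonoidHom α⁻¹).comp a) ((MulEquiv.toMonoidHom α⁻¹).comp b))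
    {a : K →* S} (ha : Function.Injective a) (b : K →* S) :
    mark ((MulEquiv.toMonoidHom α).comp a) ((MulEquiv.toMonoidHom α).comp b) ω =
      mark a b ω := by
  have hinv (c : K →* S) : (MulEquiv.toMonoidHom α⁻¹).comp ((MulEquiv.toMonoidHom α).comp c) = c :=
    MonoidHom.ext fun k => α.symm_apply_apply (c k)
  have hinv' (c : K →* S) :
      (MulEquiv.toMonoidHom α).comp ((MulEquiv.toMonoidHom α⁻¹).comp c) = c :=
    MonoidHom.ext fun k => α.apply_symm_apply (c k)
  have hαa : Function.Injective ((MulEquiv.toMonoidHom α).comp a) := α.injective.comp ha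
  have hiff (c : K →* S) : E.Rel a c ↔
      E.Rel ((MulEquiv.toMonoidHom α).comp a) ((MulEquiv.toMonoidHom α).comp c) := by
    refine ⟨hα, fun h => ?_⟩
    have := hα' h
    rwa [hinv, hinv] at this
  -- For related `a` and `b` the mark depends only on the number of conjugates of `a`, which `α`
  -- preserves. Otherwise both marks vanish.
  by_cases h : E.Rel a b
  · rw [← hω.leftStable.mark_eq _ h, ← hω.leftStable.mark_eq _ ((hiff b).mp h)]
    have e : {ρ : K →* S // E.Rel a ρ} ≃
        {ρ : K →* S // E.Rel ((MulEquiv.toMonoidHom α).comp a) ρ} :=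
      Equiv.subtypeEquiv ⟨fun c => (MulEquiv.toMonoidHom α).comp c,
        fun c => (MulEquiv.toMonoidHom α⁻¹).comp c, hinv, hinv'⟩ hiff
    have h1 := hω.card_eq_mul_mark hS ha
    have h2 := hω.card_eq_mul_mark hS hαa
    rw [← Nat.card_congr e, h1] at h2
    refine (mul_left_cancel₀ (fun h0 => ?_) h2).symm
    rw [h0, zero_mul, Nat.cast_eq_zero] at h1
    exact Nat.card_pos.ne' h1
  · have h0 {x y : K →* S} (hx : Function.Injective x) (hr : ¬ E.Rel x y) : mark x y ω = 0 := by
      by_contra hne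
      exact hr (hω.generated.rel_of_mark_ne_zero hx hne)
    rw [h0 ha h, h0 hαa fun hr => h ((hiff b).mpr hr)]

end IsCharIdempotent

/-- This converts the two sides of the identity in condition 2 into marks of `ω` itself. -/
theorem mark_tr_comp_res {Q : Type u} [Group Q] [Finite Q] (f : Q →* S)
    (hf : Function.Injective f) (a b : K →* Q) :
    mark a b (BurnsideLoc.comp (tr p f hf) (BurnsideLoc.comp ω (res p f))) =
      mark (f.comp a) (f.comp b) ω := by
  rw [mark_tr_comp, mark_comp_res]

/-! ### The two implications. -/

variable {F : FusionSystem S} {T : Subgroup S} {E : FusionSystem T} {ω : BurnsideLoc p T T}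

/-- The characteristic idempotent of a normal subsystem is invariant under the morphisms of the
ambient fusion system. -/
theorem IsNormal.comp_eq (hN : F.IsNormal E) (hS : IsPGroup p S) (hF : F.Saturated p)
    (hω : E.IsCharIdempotent ω) (hT : F.StronglyClosed T) {Q : Subgroup S} (hQ : Q ≤ T)
    {ψ : Q →* (⊤ : Subgroup S)} (hψ : ψ ∈ F.Hom Q ⊤) :
    BurnsideLoc.comp (tr p (hT.toMap hQ hψ) (hT.toMap_injective hQ hψ))
        (BurnsideLoc.comp ω (res p (hT.toMap hQ hψ))) =
      BurnsideLoc.comp (tr p (Subgroup.inclusion hQ) (Subgroup.inclusion_injective hQ))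
        (BurnsideLoc.comp ω (res p (Subgroup.inclusion hQ))) := by
  have hT' : IsPGroup p T := hS.to_subgroup T
  refine ext_mark fun P φ => ?_
  rw [mark_tr_comp_res, mark_tr_comp_res]
  set i := Subgroup.inclusion hQ
  set j := hT.toMap hQ hψ
  have hi : Function.Injective i := Subgroup.inclusion_injective hQ
  have hj : Function.Injective j := hT.toMap_injective hQ hψ
  have hP : Function.Injective P.subtype := P.subtype_injective
  -- For injective `φ`, the Frattini property relates `α ∘ i` to `j` in `E`. Stability replaces `j`
  -- by `α ∘ i` in both arguments of the mark, and `mark_aut` removes `α`. For other `φ` both marks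
  -- are zero, because `E` relates only injective maps.
  by_cases hφ : Function.Injective φ
  · obtain ⟨α, hα, h⟩ := hN.factors hS hF _ (a := i) (b := j) rfl
        ((rel_of_mem hψ).congr (fun _ => rfl) fun _ => rfl)
    rw [← hω.rightStable.mark_eq _ (h.precomp hP), ← hω.leftStable.mark_eq _ (h.precomp hφ)]
    exact hω.mark_aut hT' α (fun h => hN.rel_aut h hα) (fun h => hN.rel_aut h (inv_mem hα))
      (a := i.comp P.subtype) (fun x y e => hP (hi e)) (i.comp φ)
  · have h0 {f : Q →* T} (hf : Function.Injective f) :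
        mark (f.comp P.subtype) (f.comp φ) ω = 0 := by
      by_contra hne
      have hfP : Function.Injective (f.comp P.subtype) := fun x y e => hP (hf e)
      have h : Function.Injective (f.comp φ) :=
        (hω.generated.rel_of_mark_ne_zero hfP hne).injective_right
      exact hφ (Function.Injective.of_comp (f := f) h)
    rw [h0 hi, h0 hj]

/-- A subsystem whose characteristic idempotent is invariant under the morphisms of the ambient
fusion system is normal. -/
theorem isNormal_of_comp_eq (hS : IsPGroup p S) (hT : F.StronglyClosed T) (hEF : F.IsSubsystem E)
    (hω : E.IsCharIdempotent ω)
    (h : ∀ (Q : Subgroup S) (hQ : Q ≤ T) (ψ : Q →* (⊤ : Subgroup S)) (hψ : ψ ∈ F.Hom Q ⊤),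
      BurnsideLoc.comp (tr p (hT.toMap hQ hψ) (hT.toMap_injective hQ hψ))
          (BurnsideLoc.comp ω (res p (hT.toMap hQ hψ))) =
        BurnsideLoc.comp (tr p (Subgroup.inclusion hQ) (Subgroup.inclusion_injective hQ))
          (BurnsideLoc.comp ω (res p (Subgroup.inclusion hQ)))) :
    F.IsNormal E := by
  have hT' : IsPGroup p T := hS.to_subgroup T
  refine ⟨hEF, hT, fun Q R φ hφ A B A' B' hA hB eA eB heA heB θ hθ => ?_⟩
  let ψ : (Q ⊓ T : Subgroup S) →* (⊤ : Subgroup S) :=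
    (Subgroup.inclusion le_top).comp (φ.toMonoidHom.comp (Subgroup.inclusion inf_le_left))
  have hψ : ψ ∈ F.Hom (Q ⊓ T) ⊤ :=
    F.comp_mem (F.comp_mem (inclusion_mem _) hφ) (inclusion_mem _)
  let a₀ : A →* (Q ⊓ T : Subgroup S) := (T.subtype.comp A.subtype).codRestrict _ fun u =>
    ⟨hA (Subgroup.mem_map_of_mem T.subtype u.2), (u : T).2⟩
  let b₀ : A →* (Q ⊓ T : Subgroup S) := (T.subtype.comp (amb θ)).codRestrict _ fun u =>
    ⟨hB (Subgroup.mem_map_of_mem T.subtype (θ u).2), (θ u : T).2⟩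
  -- The identity for `φ` restricted to `Q ∩ T` is tested at the pair formed by the inclusion of `A`
  -- and `θ`. Its right side is nonzero as `θ` is in `E`; the left side is then a nonzero mark at
  -- the transported pair, which is therefore related by `E`.
  have h1 := congrArg (mark a₀ b₀) (h (Q ⊓ T) inf_le_right ψ hψ)
  rw [mark_tr_comp_res, mark_tr_comp_res] at h1
  have h2 : mark ((Subgroup.inclusion inf_le_right).comp a₀)
      ((Subgroup.inclusion inf_le_right).comp b₀) ω ≠ 0 := by
    change mark A.subtype (amb θ) ω ≠ 0
    rw [← hω.leftStable.mark_eq _ (rel_of_mem hθ)]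
    exact hω.mark_self_ne_zero hT' A.subtype_injective
  rw [← h1] at h2
  have ha₀ : Function.Injective a₀ := fun x y e =>
    Subtype.ext (Subtype.ext (congrArg (fun z => z.1) e))
  have h3 := hω.generated.rel_of_mark_ne_zero
    (fun x y e => ha₀ (hT.toMap_injective inf_le_right hψ e)) h2
  refine Rel.mem_hom_subtype ((h3.precomp (i := eA.symm.toMonoidHom) eA.symm.injective).congr
    (fun u => Subtype.ext ?_) fun u => Subtype.ext ?_)
  · refine (heA (eA.symm u)).symm.trans ?_
    rw [eA.apply_symm_apply]
    rfl
  · exact (heB (θ (eA.symm u))).symm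

end FusionSystem

theorem mainTheorem9 {p : ℕ} [Fact p.Prime] {S : Type u} [Group S] [Finite S] (hS : IsPGroup p S)
    (F : FusionSystem S) (hF : F.Saturated p)
    (T : Subgroup S) (hT : F.StronglyClosed T)
    (E : FusionSystem T) (hE : E.Saturated p) (hEF : F.IsSubsystem E)
    (ω : BurnsideLoc p T T) (hω : E.IsCharIdempotent ω) :
    F.IsNormal E ↔
      ∀ (Q : Subgroup S) (hQ : Q ≤ T) (ψ : Q →* (⊤ : Subgroup S)) (hψ : ψ ∈ F.Hom Q ⊤),
        BurnsideLoc.comp (BurnsideLoc.tr p (hT.toMap hQ hψ) (hT.toMap_injective hQ hψ))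
            (BurnsideLoc.comp ω (BurnsideLoc.res p (hT.toMap hQ hψ))) =
          BurnsideLoc.comp
            (BurnsideLoc.tr p (Subgroup.inclusion hQ) (Subgroup.inclusion_injective hQ))
            (BurnsideLoc.comp ω (BurnsideLoc.res p (Subgroup.inclusion hQ))) :=
  ⟨fun hN _ hQ _ hψ => hN.comp_eq hS hF hω hT hQ hψ,
    fun h => FusionSystem.isNormal_of_comp_eq hS hT hEF hω h⟩
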